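/- **Soundness Theorem ($\mathrm{RCA}_0$).** The following is a theorem of $\mathrm{RCA}_0$, that is, the sentence of second-order arithmetic expressing it is true in every model of $\mathrm{RCA}_0$, with an arbitrary, possibly nonstandard, first-order part and an arbitrary collection of subsets of it as second-order part (equivalently, by Gödel's completeness theorem, it is derivable in $\mathrm{RCA}_0$): for every set $\Sigma\subseteq\{T,B,4,5,D,.2,L\}$ and every modal formula $\varphi$, if $\varphi$ is provable in $\mathbf{K}\Sigma$, then $\varphi$ is valid on every frame that is appropriate to $\Sigma$. Here $\mathrm{RCA}_0$ consists of the basic axioms of arithmetic, induction for $\Sigma^0_1$ formulas and comprehension for $\Delta^0_1$ predicates, with parameters. Modal formulas ($\mathrm{Fml}$) are built from propositional variables ($\mathrm{Prop}$), propositional constants and $\bot$ by $\to$ and $\Box$, with $\neg\varphi=\varphi\to\bot$ and $\Diamond\varphi=\neg\Box\neg\varphi$, and are coded by natural numbers. For distinct fixed propositional variables $p,q,r$ the axioms are $p\to(q\to p)$, $(p\to(q\to r))\to((p\to q)\to(p\to r))$, $(\neg p\to\neg q)\to(q\to p)$ and $\Box(p\to q)\to(\Box p\to\Box q)$; $T$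 is $\Box p\to p$, $B$ is $p\to\Box\Diamond p$, $D$ is $\Box p\to\Diamond p$, $4$ is $\Box p\to\Box\Box p$, $5$ is $\Diamond p\to\Box\Diamond p$, $.2$ is $\Diamond\Box p\to\Box\Diamond p$, and $L$ is $\Box(\Box p\to p)\to\Box p$. For a finite partial function $\sigma$ from propositional variables to formulas, $\overline\sigma(\varphi)$ is the result of replacing every variable $q\in\mathrm{dom}(\sigma)$ in $\varphi$ by $\sigma(q)$ (propositional constants and variables outside $\mathrm{dom}(\sigma)$ are unchanged). A $\mathbf{K}\Sigma$-proof is a (number coding a) finite sequence of formulas, each of which is a member of $\Sigma$, or an axiom, or follows from earlier entries by modus ponens, or is $\Box\psi$ for an earlier entry $\psi$, or is $\overline\sigma(\psi)$ for an earlier entry $\psi$ and some $\sigma:\{q\in\mathrm{Prop}\mid q<\psi\}\to\{\chi\in\mathrm{Fml}\mid\chi<\overline\sigma(\psi)\}$, where $<$ compares codes; a formula is provable in $\mathbf{K}\Sigma$ if it is an entry of a $\mathbf{K}\Sigma$-proof. A frame is a pair $(W,R)$ of sets with $\emptyset\neq W\subseteq\mathbb N$ and $R\subseteq W\times W$. A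 valuation with $(W,R)$ is a function $V:W\times\mathrm{Fml}\to\{0,1\}$ (given on all formulas, as a set) such that for all $w\in W$ and all formulas $\varphi,\psi$: $V(w,\bot)=0$, $V(w,\varphi\to\psi)=1-V(w,\varphi)(1-V(w,\psi))$, and $V(w,\Box\varphi)=1$ iff $V(v,\varphi)=1$ for all $v\in W$ with $wRv$. A formula $\varphi$ is valid on $(W,R)$ if $V(w,\varphi)=1$ for every valuation $V$ with $(W,R)$ and every $w\in W$. The frame $(W,R)$ is appropriate to $T$, $B$, $4$, $5$, $D$, $.2$ if $R$ is, respectively, reflexive, symmetric, transitive, Euclidean ($wRu$ and $wRv$ imply $uRv$), serial ($\forall w\,\exists u\;wRu$), directed ($wRu$ and $wRv$ imply $\exists s\,(uRs\wedge vRs)$); it is appropriate to $L$ if $R$ is transitive and there is no $f:\mathbb N\to W$ with $f(n)\,R\,f(n+1)$ for all $n$; and it is appropriate to $\Sigma$ if it is appropriate to every member of $\Sigma$. -/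

import Mathlib

universe u

/-! ## The language of second-order arithmetic

Two-sorted first-order syntax with de Bruijn indices: a number quantifier binds number variable `0`
and shifts the other number variables by one; a set quantifier does the same for set variables. -/

namespace SOA

/-- Number terms. -/
inductive Tm : Type
  | v (i : ℕ)
  | zero
  | one
  | add (t s : Tm)
  | mul (t s : Tm)

namespace Tm

instance : Zero Tm := ⟨zero⟩
instance : One Tm := ⟨one⟩
instance : Add Tm := ⟨add⟩
instance : Mul Tm := ⟨mul⟩

/-- Increase the index of every variable of a term by one. -/
def shift : Tm → Tm
  | v i => v (i + 1)
  | zero => zero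
  | one => one
  | add t s => add t.shift s.shift
  | mul t s => mul t.shift s.shift

end Tm

/-- Formulas of second-order arithmetic; `mem t X` says that `t` belongs to the `X`-th set variable. -/
inductive Fm : Type
  | eq (t s : Tm)
  | lt (t s : Tm)
  | mem (t : Tm) (X : ℕ)
  | neg (A : Fm)
  | and (A B : Fm)
  | or (A B : Fm)
  | imp (A B : Fm)
  | iff (A B : Fm)
  | all (A : Fm)
  | ex (A : Fm)
  | allS (A : Fm)
  | exS (A : Fm)

namespace Fm

/-- Bounded (`Σ⁰₀`) formulas: all quantifiers are bounded number quantifiers `∀ x < t`, `∃ x < t`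
with `x` not in `t`. Number and set parameters are allowed. -/
inductive IsBounded : Fm → Prop
  | eq (t s : Tm) : IsBounded (eq t s)
  | lt (t s : Tm) : IsBounded (lt t s)
  | mem (t : Tm) (X : ℕ) : IsBounded (mem t X)
  | neg {A : Fm} : IsBounded A → IsBounded (neg A)
  | and {A B : Fm} : IsBounded A → IsBounded B → IsBounded (and A B)
  | or {A B : Fm} : IsBounded A → IsBounded B → IsBounded (or A B)
  | imp {A B : Fm} : IsBounded A → IsBounded B → IsBounded (imp A B)
  | iff {A B : Fm} : IsBounded A → IsBounded B → IsBounded (iff A B)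
  | ball (t : Tm) {A : Fm} : IsBounded A → IsBounded (all (imp (lt (Tm.v 0) t.shift) A))
  | bex (t : Tm) {A : Fm} : IsBounded A → IsBounded (ex (and (lt (Tm.v 0) t.shift) A))

/-- `Σ⁰₁` formulas: `∃ n, θ` with `θ` bounded. -/
def IsSigma1 (A : Fm) : Prop := ∃ B, IsBounded B ∧ A = ex B

/-- `Π⁰₁` formulas: `∀ n, θ` with `θ` bounded. -/
def IsPi1 (A : Fm) : Prop := ∃ B, IsBounded B ∧ A = all B

end Fm

/-- Assignments: `scons a e` assigns `a` to variable `0` and `e i` to variable `i + 1`. -/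
def scons {α : Type u} (a : α) (e : ℕ → α) : ℕ → α
  | 0 => a
  | i + 1 => e i

/-- Structures for the language of second-order arithmetic: an arbitrary (possibly nonstandard)
first-order part together with a nonempty collection of subsets of it. -/
structure L2Structure : Type (u + 1) where
  Num : Type u
  zero : Num
  one : Num
  add : Num → Num → Num
  mul : Num → Num → Num
  lt : Num → Num → Prop
  sets : Set (Set Num)
  sets_nonempty : sets.Nonempty

namespace L2Structure

instance (M : L2Structure.{u}) : Zero M.Num := ⟨M.zero⟩
instance (M : L2Structure.{u}) : One M.Num := ⟨M.one⟩
instance (M : L2Structure.{u}) : Add M.Num := ⟨M.add⟩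
instance (M : L2Structure.{u}) : Mul M.Num := ⟨M.mul⟩
instance (M : L2Structure.{u}) : LT M.Num := ⟨M.lt⟩
instance (M : L2Structure.{u}) : Membership M.Num M.sets := ⟨fun X a => a ∈ X.1⟩

/-- The value of a term. -/
def val (M : L2Structure.{u}) (e : ℕ → M.Num) : Tm → M.Num
  | .v i => e i
  | .zero => 0
  | .one => 1
  | .add t s => M.val e t + M.val e s
  | .mul t s => M.val e t * M.val e s

/-- Satisfaction of a formula under an assignment; set quantifiers range over `M.sets`. -/
def Sat (M : L2Structure.{u}) : (ℕ → M.Num) → (ℕ → M.sets) → Fm → Prop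
  | e, _, .eq t s => M.val e t = M.val e s
  | e, _, .lt t s => M.val e t < M.val e s
  | e, E, .mem t X => M.val e t ∈ E X
  | e, E, .neg A => ¬ M.Sat e E A
  | e, E, .and A B => M.Sat e E A ∧ M.Sat e E B
  | e, E, .or A B => M.Sat e E A ∨ M.Sat e E B
  | e, E, .imp A B => M.Sat e E A → M.Sat e E B
  | e, E, .iff A B => (M.Sat e E A ↔ M.Sat e E B)
  | e, E, .all A => ∀ a : M.Num, M.Sat (scons a e) E A
  | e, E, .ex A => ∃ a : M.Num, M.Sat (scons a e) E A
  | e, E, .allS A => ∀ X : M.sets, M.Sat e (scons X E) A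
  | e, E, .exS A => ∃ X : M.sets, M.Sat e (scons X E) A

/-- `M` is a model of (the universal closure of) a formula. -/
def Models (M : L2Structure.{u}) (A : Fm) : Prop :=
  ∀ (e : ℕ → M.Num) (E : ℕ → M.sets), M.Sat e E A

/-- `M` is a model of `RCA₀`: the basic axioms, the `Σ⁰₁` induction scheme and the `Δ⁰₁`
comprehension scheme, with arbitrary number and set parameters from `M`. -/
structure IsModelRCA0 (M : L2Structure.{u}) : Prop where
  succ_ne_zero : ∀ a : M.Num, a + 1 ≠ 0
  succ_inj : ∀ a b : M.Num, a + 1 = b + 1 → a = b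
  add_zero : ∀ a : M.Num, a + 0 = a
  add_succ : ∀ a b : M.Num, a + (b + 1) = (a + b) + 1
  mul_zero : ∀ a : M.Num, a * 0 = 0
  mul_succ : ∀ a b : M.Num, a * (b + 1) = a * b + a
  not_lt_zero : ∀ a : M.Num, ¬ a < 0
  lt_succ : ∀ a b : M.Num, a < b + 1 ↔ (a < b ∨ a = b)
  sigma1_induction : ∀ A : Fm, A.IsSigma1 → ∀ (e : ℕ → M.Num) (E : ℕ → M.sets),
    M.Sat (scons 0 e) E A →
    (∀ a : M.Num, M.Sat (scons a e) E A → M.Sat (scons (a + 1) e) E A) →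
    ∀ a : M.Num, M.Sat (scons a e) E A
  delta1_comprehension : ∀ A B : Fm, A.IsSigma1 → B.IsPi1 →
    ∀ (e : ℕ → M.Num) (E : ℕ → M.sets),
    (∀ a : M.Num, M.Sat (scons a e) E A ↔ M.Sat (scons a e) E B) →
    {a : M.Num | M.Sat (scons a e) E A} ∈ M.sets

end L2Structure

/-! ## Codes

The following polynomials are used both for terms and for elements of a structure. -/

section Codes

variable {α : Type u} [Zero α] [One α] [Add α] [Mul α]

/-- The code of an ordered pair (twice the Cantor pairing function). -/
def pairC (x y : α) : α := (x + y) * (x + y + 1) + (1 + 1) * y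

/-! Gödel numbers of modal formulas. Writing `c(a, b)` for the (bijective) Cantor pairing function,
`⊥` is `0`, the `k`-th propositional variable is `4k+1`, the `k`-th propositional constant is `4k+2`,
`□a` is `4a+3` and `a → b` is `4 c(a,b) + 4`. Every number is the code of exactly one formula, so that
`Fml` is the set of all numbers, and proper subformulas have smaller codes. -/

def botC : α := 0
def varC (k : α) : α := (1 + 1 + 1 + 1) * k + 1
def constC (k : α) : α := (1 + 1 + 1 + 1) * k + (1 + 1)
def boxC (a : α) : α := (1 + 1 + 1 + 1) * a + (1 + 1 + 1)
def impC (a b : α) : α := (1 + 1) * pairC a b + (1 + 1 + 1 + 1)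

def negC (a : α) : α := impC a botC
def diaC (a : α) : α := negC (boxC (negC a))

/-- Three fixed propositional variables. -/
def pC : α := varC 0
def qC : α := varC 1
def rC : α := varC (1 + 1)

def axm1 : α := impC pC (impC qC pC)
def axm2 : α := impC (impC pC (impC qC rC)) (impC (impC pC qC) (impC pC rC))
def axm3 : α := impC (impC (negC pC) (negC qC)) (impC qC pC)
def axmK : α := impC (boxC (impC pC qC)) (impC (boxC pC) (boxC qC))

def frmT : α := impC (boxC pC) pC
def frmB : α := impC pC (boxC (diaC pC))
def frmD : α := impC (boxC pC) (diaC pC)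
def frm4 : α := impC (boxC pC) (boxC (boxC pC))
def frm5 : α := impC (diaC pC) (boxC (diaC pC))
def frm2 : α := impC (diaC (boxC pC)) (boxC (diaC pC))
def frmL : α := impC (boxC (impC (boxC pC) pC)) (boxC pC)

end Codes

/-! ## The soundness statement inside a structure -/

namespace L2Structure

/-- `s` codes a finite sequence. A sequence of length `l` is coded, with Gödel's `β` function, by
`⟨⟨a, b⟩, l⟩`; its `i`-th entry, `i < l`, is the remainder of `a` modulo `1 + (i+1) b`. -/
def IsSeq (M : L2Structure.{u}) (s : M.Num) : Prop :=
  ∃ a b l : M.Num, s = pairC (pairC a b) l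

/-- `i < lh(s)` and `s(i) = x`. -/
def Entry (M : L2Structure.{u}) (s i x : M.Num) : Prop :=
  ∃ a b l c : M.Num, s = pairC (pairC a b) l ∧ i < l ∧
    a = c * (1 + (i + 1) * b) + x ∧ x < 1 + (i + 1) * b

/-- A finite partial function `σ` from propositional variables to formulas is coded by a finite
sequence `s`: `σ(p_k) = x` if `s(k) = x + 1`, and `p_k ∉ dom σ` if `s(k) = 0` or `lh(s) ≤ k`. -/
def FunVal (M : L2Structure.{u}) (σ k x : M.Num) : Prop :=
  ∃ y : M.Num, M.Entry σ k y ∧ y = x + 1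

/-- The value `x` of the uniform substitution for `σ` at the formula `n` is as prescribed by the
recursion clauses from the values at smaller formulas listed in the sequence `t`. -/
def SubstStep (M : L2Structure.{u}) (σ t n x : M.Num) : Prop :=
  (n = botC → x = botC) ∧
  (∀ k : M.Num, n = varC k →
    (∀ y : M.Num, M.FunVal σ k y → x = y) ∧ ((¬ ∃ y : M.Num, M.FunVal σ k y) → x = n)) ∧
  (∀ k : M.Num, n = constC k → x = n) ∧
  (∀ a y : M.Num, n = boxC a → M.Entry t a y → x = boxC y) ∧
  (∀ a b y z : M.Num, n = impC a b → M.Entry t a y → M.Entry t b z → x = impC y z)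

/-- `ψ` is the result of the uniform substitution for `σ` in `φ`. -/
def Subst (M : L2Structure.{u}) (σ φ ψ : M.Num) : Prop :=
  ∃ t : M.Num, M.Entry t φ ψ ∧ ∀ n x : M.Num, M.Entry t n x → M.SubstStep σ t n x

/-- `σ` is a function from `{q < φ | q ∈ Prop}` to `{χ < ψ | χ ∈ Fml}`. -/
def IsFunBelow (M : L2Structure.{u}) (σ φ ψ : M.Num) : Prop :=
  M.IsSeq σ ∧ (∀ k : M.Num, (∃ y : M.Num, M.FunVal σ k y) ↔ varC k < φ) ∧
  ∀ k y : M.Num, M.FunVal σ k y → y < ψ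

def IsAxm (M : L2Structure.{u}) (x : M.Num) : Prop :=
  x = axm1 ∨ x = axm2 ∨ x = axm3 ∨ x = axmK

/-- The `k`-th entry `x` of `p` is in `Sg`, an axiom, or follows from earlier entries by modus ponens,
necessitation or uniform substitution. -/
def PrfStep (M : L2Structure.{u}) (Sg : M.sets) (p k x : M.Num) : Prop :=
  x ∈ Sg ∨ M.IsAxm x ∨
  (∃ i j y z : M.Num, i < k ∧ j < k ∧ M.Entry p i y ∧ M.Entry p j z ∧ y = impC z x) ∨
  (∃ i y : M.Num, i < k ∧ M.Entry p i y ∧ x = boxC y) ∨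
  (∃ i y σ : M.Num, i < k ∧ M.Entry p i y ∧ M.IsFunBelow σ y x ∧ M.Subst σ y x)

/-- `p` is a `KΣ`-proof (from no hypotheses). -/
def Prf (M : L2Structure.{u}) (Sg : M.sets) (p : M.Num) : Prop :=
  M.IsSeq p ∧ ∀ k x : M.Num, M.Entry p k x → M.PrfStep Sg p k x

/-- `φ` is provable in `KΣ` (from no hypotheses). -/
def Pbl (M : L2Structure.{u}) (Sg : M.sets) (φ : M.Num) : Prop :=
  ∃ p : M.Num, M.Prf Sg p ∧ ∃ i : M.Num, M.Entry p i φ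

/-- `(W, R)` is a frame. -/
def IsFrame (M : L2Structure.{u}) (W R : M.sets) : Prop :=
  (∃ w : M.Num, w ∈ W) ∧
  ∀ z : M.Num, z ∈ R → ∃ x y : M.Num, x ∈ W ∧ y ∈ W ∧ z = pairC x y

/-- `V` is a valuation with `(W, R)`: (the graph of) a function `W × Fml → {0, 1}` such that
`V(w, ⊥) = 0`, `V(w, φ → ψ) = 1 - V(w, φ) (1 - V(w, ψ))`, and
`V(w, □φ) = 1` iff `V(v, φ) = 1` for all `v ∈ W` with `w R v`. -/
def IsValuation (M : L2Structure.{u}) (W R V : M.sets) : Prop :=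
  (∀ z : M.Num, z ∈ V → ∃ w φ i : M.Num, w ∈ W ∧ (i = 0 ∨ i = 1) ∧ z = pairC (pairC w φ) i) ∧
  (∀ w φ : M.Num, w ∈ W → ∃ i : M.Num, pairC (pairC w φ) i ∈ V) ∧
  (∀ w φ i j : M.Num, pairC (pairC w φ) i ∈ V → pairC (pairC w φ) j ∈ V → i = j) ∧
  (∀ w : M.Num, w ∈ W → pairC (pairC w botC) 0 ∈ V) ∧
  (∀ w φ ψ i j k : M.Num, w ∈ W → pairC (pairC w φ) i ∈ V → pairC (pairC w ψ) j ∈ V →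
    pairC (pairC w (impC φ ψ)) k ∈ V → k + i = 1 + i * j) ∧
  (∀ w φ : M.Num, w ∈ W → (pairC (pairC w (boxC φ)) 1 ∈ V ↔
    ∀ x : M.Num, x ∈ W → pairC w x ∈ R → pairC (pairC x φ) 1 ∈ V))

def Reflexive (M : L2Structure.{u}) (W R : M.sets) : Prop :=
  ∀ x : M.Num, x ∈ W → pairC x x ∈ R

def Symmetric (M : L2Structure.{u}) (R : M.sets) : Prop :=
  ∀ x y : M.Num, pairC x y ∈ R → pairC y x ∈ R

def Transitive (M : L2Structure.{u}) (R : M.sets) : Prop :=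
  ∀ x y z : M.Num, pairC x y ∈ R → pairC y z ∈ R → pairC x z ∈ R

def Euclidean (M : L2Structure.{u}) (R : M.sets) : Prop :=
  ∀ x y z : M.Num, pairC x y ∈ R → pairC x z ∈ R → pairC y z ∈ R

def Serial (M : L2Structure.{u}) (W R : M.sets) : Prop :=
  ∀ x : M.Num, x ∈ W → ∃ y : M.Num, pairC x y ∈ R

def Directed (M : L2Structure.{u}) (R : M.sets) : Prop :=
  ∀ x y z : M.Num, pairC x y ∈ R → pairC x z ∈ R →
    ∃ s : M.Num, pairC y s ∈ R ∧ pairC z s ∈ R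

/-- `F` is (the graph of) a function `f : ℕ → W` with `f(n) R f(n+1)` for all `n`. -/
def IsAscending (M : L2Structure.{u}) (W R F : M.sets) : Prop :=
  (∀ z : M.Num, z ∈ F → ∃ n x : M.Num, x ∈ W ∧ z = pairC n x) ∧
  (∀ n : M.Num, ∃ x : M.Num, pairC n x ∈ F) ∧
  (∀ n x y : M.Num, pairC n x ∈ F → pairC n y ∈ F → x = y) ∧
  (∀ n x y : M.Num, pairC n x ∈ F → pairC (n + 1) y ∈ F → pairC x y ∈ R)

/-- The frame `(W, R)` is appropriate to the set `Sg` of formulas. -/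
def Appropriate (M : L2Structure.{u}) (Sg W R : M.sets) : Prop :=
  (frmT ∈ Sg → M.Reflexive W R) ∧
  (frmB ∈ Sg → M.Symmetric R) ∧
  (frm4 ∈ Sg → M.Transitive R) ∧
  (frm5 ∈ Sg → M.Euclidean R) ∧
  (frmD ∈ Sg → M.Serial W R) ∧
  (frm2 ∈ Sg → M.Directed R) ∧
  (frmL ∈ Sg → M.Transitive R ∧ ¬ ∃ F : M.sets, M.IsAscending W R F)

/-- `Sg ⊆ {T, B, 4, 5, D, .2, L}`. -/
def IsLogic (M : L2Structure.{u}) (Sg : M.sets) : Prop :=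
  ∀ x : M.Num, x ∈ Sg →
    x = frmT ∨ x = frmB ∨ x = frm4 ∨ x = frm5 ∨ x = frmD ∨ x = frm2 ∨ x = frmL

/-- `φ` is valid on all frames appropriate to `Sg`. -/
def Valid (M : L2Structure.{u}) (Sg : M.sets) (φ : M.Num) : Prop :=
  ∀ W R : M.sets, M.IsFrame W R → M.Appropriate Sg W R →
    ∀ V : M.sets, M.IsValuation W R V → ∀ w : M.Num, w ∈ W → pairC (pairC w φ) 1 ∈ V

/-- For all `Sg ⊆ {T, B, 4, 5, D, .2, L}`, every formula that is provable in `KΣ` is valid on all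
frames appropriate to `Sg`. -/
def Soundness (M : L2Structure.{u}) : Prop :=
  ∀ Sg : M.sets, M.IsLogic Sg → ∀ φ : M.Num, M.Pbl Sg φ → M.Valid Sg φ

end L2Structure

/-! ## The soundness statement as a sentence of second-order arithmetic

Each formula below expresses the property of the same name above; its arguments are the indices of
its free variables. That the final sentence expresses `Soundness` is `sat_soundness`. -/

namespace Fm

open Tm (v)

def isSeq (s : ℕ) : Fm := ex (ex (ex (eq (v (s + 3)) (pairC (pairC (v 2) (v 1)) (v 0)))))

def entry (s i x : ℕ) : Fm :=
  ex (ex (ex (ex (and (eq (v (s + 4)) (pairC (pairC (v 3) (v 2)) (v 1)))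
    (and (lt (v (i + 4)) (v 1))
    (and (eq (v 3) (v 0 * (1 + (v (i + 4) + 1) * v 2) + v (x + 4)))
      (lt (v (x + 4)) (1 + (v (i + 4) + 1) * v 2))))))))

def funVal (σ k x : ℕ) : Fm := ex (and (entry (σ + 1) (k + 1) 0) (eq (v 0) (v (x + 1) + 1)))

def substStep (σ t n x : ℕ) : Fm :=
  and (imp (eq (v n) botC) (eq (v x) botC))
  (and (all (imp (eq (v (n + 1)) (varC (v 0)))
    (and (all (imp (funVal (σ + 2) 1 0) (eq (v (x + 2)) (v 0))))
      (imp (neg (ex (funVal (σ + 2) 1 0))) (eq (v (x + 1)) (v (n + 1)))))))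
  (and (all (imp (eq (v (n + 1)) (constC (v 0))) (eq (v (x + 1)) (v (n + 1)))))
  (and (all (all (imp (eq (v (n + 2)) (boxC (v 1))) (imp (entry (t + 2) 1 0)
    (eq (v (x + 2)) (boxC (v 0)))))))
  (all (all (all (all (imp (eq (v (n + 4)) (impC (v 3) (v 2))) (imp (entry (t + 4) 3 1)
    (imp (entry (t + 4) 2 0) (eq (v (x + 4)) (impC (v 1) (v 0)))))))))))))

def subst (σ φ ψ : ℕ) : Fm :=
  ex (and (entry 0 (φ + 1) (ψ + 1))
    (all (all (imp (entry 2 1 0) (substStep (σ + 3) 2 1 0)))))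

def isFunBelow (σ φ ψ : ℕ) : Fm :=
  and (isSeq σ)
  (and (all (iff (ex (funVal (σ + 2) 1 0)) (lt (varC (v 0)) (v (φ + 1)))))
    (all (all (imp (funVal (σ + 2) 1 0) (lt (v 0) (v (ψ + 2)))))))

def isAxm (x : ℕ) : Fm :=
  or (eq (v x) axm1) (or (eq (v x) axm2) (or (eq (v x) axm3) (eq (v x) axmK)))

def prfStep (Sg : ℕ) (p k x : ℕ) : Fm :=
  or (mem (v x) Sg)
  (or (isAxm x)
  (or (ex (ex (ex (ex (and (lt (v 3) (v (k + 4))) (and (lt (v 2) (v (k + 4)))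
    (and (entry (p + 4) 3 1) (and (entry (p + 4) 2 0) (eq (v 1) (impC (v 0) (v (x + 4))))))))))))
  (or (ex (ex (and (lt (v 1) (v (k + 2))) (and (entry (p + 2) 1 0)
    (eq (v (x + 2)) (boxC (v 0)))))))
  (ex (ex (ex (and (lt (v 2) (v (k + 3))) (and (entry (p + 3) 2 1)
    (and (isFunBelow 0 1 (x + 3)) (subst 0 1 (x + 3)))))))))))

def prf (Sg p : ℕ) : Fm :=
  and (isSeq p) (all (all (imp (entry (p + 2) 1 0) (prfStep Sg (p + 2) 1 0))))

def pbl (Sg φ : ℕ) : Fm := ex (and (prf Sg 0) (ex (entry 1 0 (φ + 2))))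

def isFrame (W R : ℕ) : Fm :=
  and (ex (mem (v 0) W))
    (all (imp (mem (v 0) R)
      (ex (ex (and (mem (v 1) W) (and (mem (v 0) W) (eq (v 2) (pairC (v 1) (v 0)))))))))

def isValuation (W R V : ℕ) : Fm :=
  and (all (imp (mem (v 0) V) (ex (ex (ex (and (mem (v 2) W)
    (and (or (eq (v 0) 0) (eq (v 0) 1)) (eq (v 3) (pairC (pairC (v 2) (v 1)) (v 0))))))))))
  (and (all (all (imp (mem (v 1) W) (ex (mem (pairC (pairC (v 2) (v 1)) (v 0)) V)))))
  (and (all (all (all (all (imp (mem (pairC (pairC (v 3) (v 2)) (v 1)) V)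
    (imp (mem (pairC (pairC (v 3) (v 2)) (v 0)) V) (eq (v 1) (v 0))))))))
  (and (all (imp (mem (v 0) W) (mem (pairC (pairC (v 0) botC) 0) V)))
  (and (all (all (all (all (all (all (imp (mem (v 5) W)
    (imp (mem (pairC (pairC (v 5) (v 4)) (v 2)) V)
    (imp (mem (pairC (pairC (v 5) (v 3)) (v 1)) V)
    (imp (mem (pairC (pairC (v 5) (impC (v 4) (v 3))) (v 0)) V)
      (eq (v 0 + v 2) (1 + v 2 * v 1))))))))))))
  (all (all (imp (mem (v 1) W) (iff (mem (pairC (pairC (v 1) (boxC (v 0))) 1) V)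
    (all (imp (mem (v 0) W) (imp (mem (pairC (v 2) (v 0)) R)
      (mem (pairC (pairC (v 0) (v 1)) 1) V))))))))))))

def reflexive (W R : ℕ) : Fm := all (imp (mem (v 0) W) (mem (pairC (v 0) (v 0)) R))

def symmetric (R : ℕ) : Fm :=
  all (all (imp (mem (pairC (v 1) (v 0)) R) (mem (pairC (v 0) (v 1)) R)))

def transitive (R : ℕ) : Fm :=
  all (all (all (imp (mem (pairC (v 2) (v 1)) R) (imp (mem (pairC (v 1) (v 0)) R)
    (mem (pairC (v 2) (v 0)) R)))))

def euclidean (R : ℕ) : Fm :=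
  all (all (all (imp (mem (pairC (v 2) (v 1)) R) (imp (mem (pairC (v 2) (v 0)) R)
    (mem (pairC (v 1) (v 0)) R)))))

def serial (W R : ℕ) : Fm := all (imp (mem (v 0) W) (ex (mem (pairC (v 1) (v 0)) R)))

def directed (R : ℕ) : Fm :=
  all (all (all (imp (mem (pairC (v 2) (v 1)) R) (imp (mem (pairC (v 2) (v 0)) R)
    (ex (and (mem (pairC (v 2) (v 0)) R) (mem (pairC (v 1) (v 0)) R)))))))

def isAscending (W R F : ℕ) : Fm :=
  and (all (imp (mem (v 0) F) (ex (ex (and (mem (v 0) W) (eq (v 2) (pairC (v 1) (v 0))))))))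
  (and (all (ex (mem (pairC (v 1) (v 0)) F)))
  (and (all (all (all (imp (mem (pairC (v 2) (v 1)) F) (imp (mem (pairC (v 2) (v 0)) F)
    (eq (v 1) (v 0)))))))
  (all (all (all (imp (mem (pairC (v 2) (v 1)) F) (imp (mem (pairC (v 2 + 1) (v 0)) F)
    (mem (pairC (v 1) (v 0)) R))))))))

def appropriate (Sg W R : ℕ) : Fm :=
  and (imp (mem frmT Sg) (reflexive W R))
  (and (imp (mem frmB Sg) (symmetric R))
  (and (imp (mem frm4 Sg) (transitive R))
  (and (imp (mem frm5 Sg) (euclidean R))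
  (and (imp (mem frmD Sg) (serial W R))
  (and (imp (mem frm2 Sg) (directed R))
  (imp (mem frmL Sg) (and (transitive R) (neg (exS (isAscending (W + 1) (R + 1) 0))))))))))

def isLogic (Sg : ℕ) : Fm :=
  all (imp (mem (v 0) Sg) (or (eq (v 0) frmT) (or (eq (v 0) frmB) (or (eq (v 0) frm4)
    (or (eq (v 0) frm5) (or (eq (v 0) frmD) (or (eq (v 0) frm2) (eq (v 0) frmL))))))))

def valid (Sg φ : ℕ) : Fm :=
  allS (allS (imp (isFrame 1 0) (imp (appropriate (Sg + 2) 1 0)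
    (allS (imp (isValuation 2 1 0)
      (all (imp (mem (v 0) 2) (mem (pairC (pairC (v 0) (v (φ + 1))) 1) 0))))))))

/-- The soundness theorem as a sentence of second-order arithmetic. -/
def soundness : Fm := allS (imp (isLogic 0) (all (imp (pbl 0 0) (valid 0 0))))

end Fm

/-- The sentence expresses soundness in every structure. -/
theorem sat_soundness (M : L2Structure.{u}) (e : ℕ → M.Num) (E : ℕ → M.sets) :
    M.Sat e E Fm.soundness ↔ M.Soundness := Iff.rfl

end SOA

namespace SOA

/-! ## Simultaneous substitution of terms for variables -/

/-- Replace every variable `i` of a term by `ρ i`. -/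
def Tm.inst (ρ : ℕ → Tm) : Tm → Tm
  | v i => ρ i
  | zero => zero
  | one => one
  | add t s => add (t.inst ρ) (s.inst ρ)
  | mul t s => mul (t.inst ρ) (s.inst ρ)

/-- The substitution `ρ` below a number quantifier. -/
def Tm.lift (ρ : ℕ → Tm) : ℕ → Tm
  | 0 => Tm.v 0
  | i + 1 => (ρ i).shift

/-- Replace every number variable `i` by `ρ i` and every set variable `j` by `τ j`. -/
def Fm.inst : (ℕ → Tm) → (ℕ → ℕ) → Fm → Fm
  | ρ, _, .eq t s => .eq (t.inst ρ) (s.inst ρ)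
  | ρ, _, .lt t s => .lt (t.inst ρ) (s.inst ρ)
  | ρ, τ, .mem t X => .mem (t.inst ρ) (τ X)
  | ρ, τ, .neg A => .neg (A.inst ρ τ)
  | ρ, τ, .and A B => .and (A.inst ρ τ) (B.inst ρ τ)
  | ρ, τ, .or A B => .or (A.inst ρ τ) (B.inst ρ τ)
  | ρ, τ, .imp A B => .imp (A.inst ρ τ) (B.inst ρ τ)
  | ρ, τ, .iff A B => .iff (A.inst ρ τ) (B.inst ρ τ)
  | ρ, τ, .all A => .all (A.inst (Tm.lift ρ) τ)
  | ρ, τ, .ex A => .ex (A.inst (Tm.lift ρ) τ)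
  | ρ, τ, .allS A => .allS (A.inst ρ (fun n => Nat.casesOn n 0 (fun i => τ i + 1)))
  | ρ, τ, .exS A => .exS (A.inst ρ (fun n => Nat.casesOn n 0 (fun i => τ i + 1)))

theorem Tm.shift_inst_lift (ρ : ℕ → Tm) (t : Tm) :
    t.shift.inst (Tm.lift ρ) = (t.inst ρ).shift := by
  induction t with
  | v i => rfl
  | zero => rfl
  | one => rfl
  | add t s ht hs => simp only [Tm.shift, Tm.inst, ht, hs]
  | mul t s ht hs => simp only [Tm.shift, Tm.inst, ht, hs]

theorem Fm.IsBounded.inst {A : Fm} (h : A.IsBounded) :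
    ∀ (ρ : ℕ → Tm) (τ : ℕ → ℕ), (A.inst ρ τ).IsBounded := by
  induction h with
  | eq t s => intro ρ τ; exact .eq _ _
  | lt t s => intro ρ τ; exact .lt _ _
  | mem t X => intro ρ τ; exact .mem _ _
  | neg _ ih => intro ρ τ; exact .neg (ih ρ τ)
  | and _ _ ih₁ ih₂ => intro ρ τ; exact .and (ih₁ ρ τ) (ih₂ ρ τ)
  | or _ _ ih₁ ih₂ => intro ρ τ; exact .or (ih₁ ρ τ) (ih₂ ρ τ)
  | imp _ _ ih₁ ih₂ => intro ρ τ; exact .imp (ih₁ ρ τ) (ih₂ ρ τ)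
  | iff _ _ ih₁ ih₂ => intro ρ τ; exact .iff (ih₁ ρ τ) (ih₂ ρ τ)
  | ball t _ ih =>
    intro ρ τ
    have := IsBounded.ball (t.inst ρ) (ih (Tm.lift ρ) τ)
    rwa [← Tm.shift_inst_lift] at this
  | bex t _ ih =>
    intro ρ τ
    have := IsBounded.bex (t.inst ρ) (ih (Tm.lift ρ) τ)
    rwa [← Tm.shift_inst_lift] at this

namespace L2Structure

variable {M : L2Structure.{u}}

theorem val_inst (e : ℕ → M.Num) (ρ : ℕ → Tm) (t : Tm) :
    M.val e (t.inst ρ) = M.val (fun i => M.val e (ρ i)) t := by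
  induction t with
  | v i => rfl
  | zero => rfl
  | one => rfl
  | add t s ht hs => simp only [Tm.inst, val, ht, hs]
  | mul t s ht hs => simp only [Tm.inst, val, ht, hs]

theorem val_shift (e : ℕ → M.Num) (a : M.Num) (t : Tm) :
    M.val (scons a e) t.shift = M.val e t := by
  induction t with
  | v i => rfl
  | zero => rfl
  | one => rfl
  | add t s ht hs => simp only [Tm.shift, val, ht, hs]
  | mul t s ht hs => simp only [Tm.shift, val, ht, hs]

theorem val_lift (e : ℕ → M.Num) (ρ : ℕ → Tm) (a : M.Num) :
    (fun i => M.val (scons a e) (Tm.lift ρ i)) = scons a (fun i => M.val e (ρ i)) := by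
  funext i
  cases i with
  | zero => rfl
  | succ i => exact val_shift e a (ρ i)

theorem sat_inst (A : Fm) : ∀ (ρ : ℕ → Tm) (τ : ℕ → ℕ) (e : ℕ → M.Num) (E : ℕ → M.sets),
    M.Sat e E (A.inst ρ τ) ↔ M.Sat (fun i => M.val e (ρ i)) (fun j => E (τ j)) A := by
  induction A with
  | eq t s => intro ρ τ e E; simp only [Fm.inst, Sat, val_inst]
  | lt t s => intro ρ τ e E; simp only [Fm.inst, Sat, val_inst]
  | mem t X => intro ρ τ e E; simp only [Fm.inst, Sat, val_inst]
  | neg A ih => intro ρ τ e E; simp only [Fm.inst, Sat, ih]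
  | and A B ih₁ ih₂ => intro ρ τ e E; simp only [Fm.inst, Sat, ih₁, ih₂]
  | or A B ih₁ ih₂ => intro ρ τ e E; simp only [Fm.inst, Sat, ih₁, ih₂]
  | imp A B ih₁ ih₂ => intro ρ τ e E; simp only [Fm.inst, Sat, ih₁, ih₂]
  | iff A B ih₁ ih₂ => intro ρ τ e E; simp only [Fm.inst, Sat, ih₁, ih₂]
  | all A ih => intro ρ τ e E; simp only [Fm.inst, Sat, ih, val_lift]
  | ex A ih => intro ρ τ e E; simp only [Fm.inst, Sat, ih, val_lift]
  | allS A ih =>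
    intro ρ τ e E
    simp only [Fm.inst, Sat, ih]
    refine forall_congr' fun X => ?_
    rw [show (fun j => scons X E (Nat.casesOn j 0 fun i => τ i + 1)) = scons X (fun j => E (τ j))
      from funext fun j => by cases j <;> rfl]
  | exS A ih =>
    intro ρ τ e E
    simp only [Fm.inst, Sat, ih]
    refine exists_congr fun X => ?_
    rw [show (fun j => scons X E (Nat.casesOn j 0 fun i => τ i + 1)) = scons X (fun j => E (τ j))
      from funext fun j => by cases j <;> rfl]

/-! ## Definable functions and predicates of assignments, with parameters -/

/-- The value of a variable or parameter. -/
def look (e : ℕ → M.Num) : ℕ ⊕ M.Num → M.Num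
  | .inl i => e i
  | .inr c => c

/-- Functions of an assignment given by terms with parameters. -/
class TD (T : (ℕ → M.Num) → M.Num) : Prop where
  out : ∃ (t : Tm) (g : ℕ → ℕ ⊕ M.Num), ∀ e, T e = M.val (fun i => look e (g i)) t

/-- Predicates of an assignment given by bounded formulas with parameters. -/
class D0 (P : (ℕ → M.Num) → Prop) : Prop where
  out : ∃ B : Fm, B.IsBounded ∧ ∃ (g : ℕ → ℕ ⊕ M.Num) (E : ℕ → M.sets),
    ∀ e, P e ↔ M.Sat (fun i => look e (g i)) E B

/-- Interleaving of two assignments. -/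
def inter {α : Type*} (f g : ℕ → α) (n : ℕ) : α := if n % 2 = 0 then f (n / 2) else g (n / 2)

@[simp] theorem inter_even {α : Type*} (f g : ℕ → α) (n : ℕ) : inter f g (2 * n) = f n := by
  simp [inter]

@[simp] theorem inter_odd {α : Type*} (f g : ℕ → α) (n : ℕ) : inter f g (2 * n + 1) = g n := by
  have h : (2 * n + 1) / 2 = n := by omega
  simp [inter, h, Nat.add_mod]

theorem TD.merge {T S : (ℕ → M.Num) → M.Num} (hT : TD T) (hS : TD S) :
    ∃ (t s : Tm) (g : ℕ → ℕ ⊕ M.Num), (∀ e, T e = M.val (fun i => look e (g i)) t) ∧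
      ∀ e, S e = M.val (fun i => look e (g i)) s := by
  obtain ⟨t, g, ht⟩ := hT.out
  obtain ⟨s, k, hs⟩ := hS.out
  refine ⟨t.inst fun i => .v (2 * i), s.inst fun i => .v (2 * i + 1), inter g k,
    fun e => ?_, fun e => ?_⟩
  · simp [val_inst, val, ht]
  · simp [val_inst, val, hs]

theorem D0.merge {P Q : (ℕ → M.Num) → Prop} (hP : D0 P) (hQ : D0 Q) :
    ∃ A B : Fm, A.IsBounded ∧ B.IsBounded ∧ ∃ (g : ℕ → ℕ ⊕ M.Num) (E : ℕ → M.sets),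
      (∀ e, P e ↔ M.Sat (fun i => look e (g i)) E A) ∧
      ∀ e, Q e ↔ M.Sat (fun i => look e (g i)) E B := by
  obtain ⟨A, hA, g, E, h⟩ := hP.out
  obtain ⟨B, hB, k, F, h'⟩ := hQ.out
  refine ⟨_, _, hA.inst (fun i => .v (2 * i)) (fun i => 2 * i),
    hB.inst (fun i => .v (2 * i + 1)) (fun i => 2 * i + 1), inter g k, inter E F,
    fun e => ?_, fun e => ?_⟩
  · simp [sat_inst, val, h]
  · simp [sat_inst, val, h']

theorem D0.congr {P Q : (ℕ → M.Num) → Prop} (hQ : D0 Q) (h : ∀ e, P e ↔ Q e) : D0 P := by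
  rwa [show P = Q from funext fun e => propext (h e)]

instance TD.const (a : M.Num) : TD (fun _ : ℕ → M.Num => a) :=
  ⟨.v 0, fun _ => .inr a, fun _ => rfl⟩

instance TD.var (i : ℕ) : TD (fun e : ℕ → M.Num => e i) :=
  ⟨.v 0, fun _ => .inl i, fun _ => rfl⟩

instance TD.add {T S : (ℕ → M.Num) → M.Num} [hT : TD T] [hS : TD S] :
    TD (fun e => T e + S e) := by
  obtain ⟨t, s, g, ht, hs⟩ := hT.merge hS
  exact ⟨.add t s, g, fun e => by simp only [val, ht, hs]⟩

instance TD.mul {T S : (ℕ → M.Num) → M.Num} [hT : TD T] [hS : TD S] :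
    TD (fun e => T e * S e) := by
  obtain ⟨t, s, g, ht, hs⟩ := hT.merge hS
  exact ⟨.mul t s, g, fun e => by simp only [val, ht, hs]⟩

theorem exists_sets (M : L2Structure.{u}) : ∃ _ : ℕ → M.sets, True :=
  let ⟨X, hX⟩ := M.sets_nonempty
  ⟨fun _ => ⟨X, hX⟩, trivial⟩

instance D0.eq {T S : (ℕ → M.Num) → M.Num} [hT : TD T] [hS : TD S] : D0 (fun e => T e = S e) := by
  obtain ⟨t, s, g, ht, hs⟩ := hT.merge hS
  obtain ⟨E, -⟩ := exists_sets M
  exact ⟨.eq t s, .eq _ _, g, E, fun e => by simp only [Sat, ht, hs]⟩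

instance D0.lt {T S : (ℕ → M.Num) → M.Num} [hT : TD T] [hS : TD S] : D0 (fun e => T e < S e) := by
  obtain ⟨t, s, g, ht, hs⟩ := hT.merge hS
  obtain ⟨E, -⟩ := exists_sets M
  exact ⟨.lt t s, .lt _ _, g, E, fun e => by simp only [Sat, ht, hs]⟩

instance D0.mem {T : (ℕ → M.Num) → M.Num} [hT : TD T] (X : M.sets) : D0 (fun e => T e ∈ X) := by
  obtain ⟨t, g, ht⟩ := hT.out
  exact ⟨.mem t 0, .mem _ _, g, fun _ => X, fun e => by simp only [Sat, ht]⟩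

instance D0.not {P : (ℕ → M.Num) → Prop} [hP : D0 P] : D0 (fun e => ¬ P e) := by
  obtain ⟨A, hA, g, E, h⟩ := hP.out
  exact ⟨.neg A, .neg hA, g, E, fun e => by simp only [Sat, h]⟩

instance D0.and {P Q : (ℕ → M.Num) → Prop} [hP : D0 P] [hQ : D0 Q] : D0 (fun e => P e ∧ Q e) := by
  obtain ⟨A, B, hA, hB, g, E, h, h'⟩ := hP.merge hQ
  exact ⟨.and A B, .and hA hB, g, E, fun e => by simp only [Sat, h, h']⟩

instance D0.or {P Q : (ℕ → M.Num) → Prop} [hP : D0 P] [hQ : D0 Q] : D0 (fun e => P e ∨ Q e) := by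
  obtain ⟨A, B, hA, hB, g, E, h, h'⟩ := hP.merge hQ
  exact ⟨.or A B, .or hA hB, g, E, fun e => by simp only [Sat, h, h']⟩

instance D0.imp {P Q : (ℕ → M.Num) → Prop} [hP : D0 P] [hQ : D0 Q] : D0 (fun e => P e → Q e) := by
  obtain ⟨A, B, hA, hB, g, E, h, h'⟩ := hP.merge hQ
  exact ⟨.imp A B, .imp hA hB, g, E, fun e => by simp only [Sat, h, h']⟩

theorem D0.comp {P : (ℕ → M.Num) → Prop} (hP : D0 P) (f : ℕ → (ℕ → M.Num) → M.Num)
    (hf : ∀ i, TD (f i)) : D0 (fun e => P (fun i => f i e)) := by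
  obtain ⟨A, hA, g, E, h⟩ := hP.out
  choose t k ht using fun i => (hf i).out
  let ρ : ℕ → Tm := fun i => match g i with
    | .inl j => (t j).inst fun m => .v (Nat.pair (j + 1) m)
    | .inr _ => .v (Nat.pair 0 i)
  let g' : ℕ → ℕ ⊕ M.Num := fun n => match n.unpair.1 with
    | 0 => g n.unpair.2
    | j + 1 => k j n.unpair.2
  refine ⟨_, hA.inst ρ id, g', E, fun e => ?_⟩
  rw [h, sat_inst]
  have : (fun i => look (fun i => f i e) (g i)) =
      fun i => M.val (fun i => look e (g' i)) (ρ i) := by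
    funext i
    rcases hi : g i with j | c
    · simp [ρ, hi, look, ht, val_inst, val, g']
    · simp [ρ, hi, look, val, g']
  rw [this]
  rfl

theorem TD.comp {T : (ℕ → M.Num) → M.Num} (hT : TD T) (f : ℕ → (ℕ → M.Num) → M.Num)
    (hf : ∀ i, TD (f i)) : TD (fun e => T (fun i => f i e)) := by
  obtain ⟨s, g, h⟩ := hT.out
  choose t k ht using fun i => (hf i).out
  let ρ : ℕ → Tm := fun i => match g i with
    | .inl j => (t j).inst fun m => .v (Nat.pair (j + 1) m)
    | .inr _ => .v (Nat.pair 0 i)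
  let g' : ℕ → ℕ ⊕ M.Num := fun n => match n.unpair.1 with
    | 0 => g n.unpair.2
    | j + 1 => k j n.unpair.2
  refine ⟨s.inst ρ, g', fun e => ?_⟩
  rw [h, val_inst]
  congr 1
  funext i
  rcases hi : g i with j | c
  · simp [ρ, hi, look, ht, val_inst, val, g']
  · simp [ρ, hi, look, val, g']

theorem D0.comp₁ {P : M.Num → Prop} (hP : D0 (fun e => P (e 0)))
    {T : (ℕ → M.Num) → M.Num} [hT : TD T] : D0 (fun e => P (T e)) :=
  hP.comp (fun _ => T) fun _ => hT

theorem D0.comp₂ {P : M.Num → M.Num → Prop} (hP : D0 (fun e => P (e 0) (e 1)))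
    {T S : (ℕ → M.Num) → M.Num} [hT : TD T] [hS : TD S] : D0 (fun e => P (T e) (S e)) :=
  hP.comp (fun i => if i = 0 then T else S) fun i => by split_ifs <;> assumption

theorem D0.comp₃ {P : M.Num → M.Num → M.Num → Prop} (hP : D0 (fun e => P (e 0) (e 1) (e 2)))
    {T S U : (ℕ → M.Num) → M.Num} [hT : TD T] [hS : TD S] [hU : TD U] :
    D0 (fun e => P (T e) (S e) (U e)) :=
  hP.comp (fun i => if i = 0 then T else if i = 1 then S else U)
    fun i => by split_ifs <;> assumption

theorem D0.comp₄ {P : M.Num → M.Num → M.Num → M.Num → Prop}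
    (hP : D0 (fun e => P (e 0) (e 1) (e 2) (e 3)))
    {T S U X : (ℕ → M.Num) → M.Num} [hT : TD T] [hS : TD S] [hU : TD U] [hX : TD X] :
    D0 (fun e => P (T e) (S e) (U e) (X e)) :=
  hP.comp (fun i => if i = 0 then T else if i = 1 then S else if i = 2 then U else X)
    fun i => by split_ifs <;> assumption

/-- Turn variable `0` of a definable predicate into the variable bound by a quantifier. -/
theorem D0.bind {P : M.Num → (ℕ → M.Num) → Prop} {T : (ℕ → M.Num) → M.Num}
    (hP : D0 (fun e => P (e 0) (fun i => e (i + 1)))) (hT : TD T) :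
    ∃ A : Fm, A.IsBounded ∧ ∃ (t : Tm) (g : ℕ → ℕ ⊕ M.Num) (E : ℕ → M.sets),
      (∀ x e, P x e ↔ M.Sat (scons x (fun i => look e (g i))) E A) ∧
      ∀ e, T e = M.val (fun i => look e (g i)) t := by
  obtain ⟨A, hA, g, E, h⟩ := hP.out
  obtain ⟨t, k, ht⟩ := hT.out
  let ρ : ℕ → Tm := fun i => match g i with
    | .inl 0 => .v 0
    | _ => .v (2 * i + 1)
  let g' : ℕ → ℕ ⊕ M.Num := fun i => match g i with
    | .inl (j + 1) => .inl j
    | x => x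
  refine ⟨_, hA.inst ρ id, t.inst fun i => .v (2 * i + 1), inter g' k, E, fun x e => ?_,
    fun e => ?_⟩
  · rw [sat_inst]
    refine (h (scons x e)).trans ?_
    have : (fun i => look (scons x e) (g i)) =
        fun i => M.val (scons x fun i => look e (inter g' k i)) (ρ i) := by
      funext i
      rcases hi : g i with (_ | j) | c
      · simp [ρ, hi, look, val, scons]
      · simp [ρ, hi, look, val, scons, g']
      · simp [ρ, hi, look, val, scons, g']
    rw [this]
    rfl
  · simp [val_inst, val, ht]

instance D0.ball {P : M.Num → (ℕ → M.Num) → Prop} {T : (ℕ → M.Num) → M.Num} [hT : TD T]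
    [hP : D0 (fun e => P (e 0) (fun i => e (i + 1)))] : D0 (fun e => ∀ x, x < T e → P x e) := by
  obtain ⟨A, hA, t, g, E, h, ht⟩ := hP.bind hT
  exact ⟨_, .ball t hA, g, E, fun e => by simp only [Sat, h, ht, val_shift, val, scons]⟩

instance D0.bex {P : M.Num → (ℕ → M.Num) → Prop} {T : (ℕ → M.Num) → M.Num} [hT : TD T]
    [hP : D0 (fun e => P (e 0) (fun i => e (i + 1)))] : D0 (fun e => ∃ x, x < T e ∧ P x e) := by
  obtain ⟨A, hA, t, g, E, h, ht⟩ := hP.bind hT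
  exact ⟨_, .bex t hA, g, E, fun e => by simp only [Sat, h, ht, val_shift, val, scons]⟩

instance TD.pairC {T S : (ℕ → M.Num) → M.Num} [TD T] [TD S] :
    TD (fun e => pairC (T e) (S e)) := by
  unfold SOA.pairC; infer_instance

instance TD.varC {T : (ℕ → M.Num) → M.Num} [TD T] : TD (fun e => varC (T e)) := by
  unfold SOA.varC; infer_instance

instance TD.constC {T : (ℕ → M.Num) → M.Num} [TD T] : TD (fun e => constC (T e)) := by
  unfold SOA.constC; infer_instance

instance TD.boxC {T : (ℕ → M.Num) → M.Num} [TD T] : TD (fun e => boxC (T e)) := by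
  unfold SOA.boxC; infer_instance

instance TD.impC {T S : (ℕ → M.Num) → M.Num} [TD T] [TD S] :
    TD (fun e => impC (T e) (S e)) := by
  unfold SOA.impC; infer_instance


end L2Structure
end SOA

namespace SOA
namespace L2Structure

variable {M : L2Structure.{u}}

theorem D0.forms {P Q : M.Num → M.Num → Prop} (hP : D0 (fun e => P (e 0) (e 1)))
    (hQ : D0 (fun e => Q (e 0) (e 1))) :
    ∃ A B : Fm, A.IsBounded ∧ B.IsBounded ∧ ∃ (c : ℕ → M.Num) (E : ℕ → M.sets),
      (∀ x a, P x a ↔ M.Sat (scons x (scons a c)) E A) ∧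
      ∀ x a, Q x a ↔ M.Sat (scons x (scons a c)) E B := by
  obtain ⟨A, B, hA, hB, g, E, h, h'⟩ := hP.merge hQ
  let ρ : ℕ → Tm := fun i => match g i with
    | .inl 0 => .v 0
    | .inl 1 => .v 1
    | _ => .v (i + 2)
  have key : ∀ x a : M.Num, (fun i => look (scons x (scons a fun _ => 0)) (g i)) =
      fun i => M.val (scons x (scons a fun i => look (fun _ => 0) (g i))) (ρ i) := by
    intro x a
    funext i
    rcases hi : g i with (_ | _ | j) | c <;> simp [ρ, hi, look, val, scons]
  refine ⟨_, _, hA.inst ρ id, hB.inst ρ id, fun i => look (fun _ => 0) (g i), E,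
    fun x a => ?_, fun x a => ?_⟩
  · rw [sat_inst]
    refine (h (scons x (scons a fun _ => 0))).trans ?_
    rw [key]
    rfl
  · rw [sat_inst]
    refine (h' (scons x (scons a fun _ => 0))).trans ?_
    rw [key]
    rfl

theorem D0.shift {P : (ℕ → M.Num) → Prop} (h : D0 P) : D0 (fun e => P (fun i => e (i + 1))) :=
  h.comp (fun i e => e (i + 1)) fun _ => inferInstance

theorem TD.scons {f : ℕ → (ℕ → M.Num) → M.Num} {T : (ℕ → M.Num) → M.Num} (hT : TD T)
    (hf : ∀ i, TD (f i)) (i : ℕ) : TD (fun e => scons (T e) (fun i => f i e) i) := by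
  cases i with
  | zero => exact hT
  | succ i => exact hf i

/-! ## `Σ₁` and `Π₁` predicates -/

/-- Predicates of an assignment given by `Σ⁰₁` formulas with parameters. -/
class S1 (P : (ℕ → M.Num) → Prop) : Prop where
  out : ∃ Q : M.Num → (ℕ → M.Num) → Prop, D0 (fun e => Q (e 0) (fun i => e (i + 1))) ∧
    ∀ e, P e ↔ ∃ x, Q x e

/-- Predicates of an assignment given by `Π⁰₁` formulas with parameters. -/
class P1 (P : (ℕ → M.Num) → Prop) : Prop where
  out : S1 (fun e => ¬ P e)

theorem S1.congr {P Q : (ℕ → M.Num) → Prop} (hQ : S1 Q) (h : ∀ e, P e ↔ Q e) : S1 P := by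
  rwa [show P = Q from funext fun e => propext (h e)]

theorem D0.s1 {P : (ℕ → M.Num) → Prop} (hP : D0 P) : S1 P :=
  ⟨fun _ e => P e, hP.shift, fun _ => ⟨fun h => ⟨0, h⟩, fun ⟨_, h⟩ => h⟩⟩

instance (priority := low) S1.of_d0 {P : (ℕ → M.Num) → Prop} [hP : D0 P] : S1 P := hP.s1

theorem S1.comp {P : (ℕ → M.Num) → Prop} (hP : S1 P) (f : ℕ → (ℕ → M.Num) → M.Num)
    (hf : ∀ i, TD (f i)) : S1 (fun e => P (fun i => f i e)) := by
  obtain ⟨Q, hQ, h⟩ := hP.out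
  refine ⟨fun x e => Q x (fun i => f i e), ?_, fun e => h _⟩
  exact hQ.comp (fun i e => scons (e 0) (fun i => f i (fun i => e (i + 1))) i)
    (TD.scons inferInstance fun i => (hf i).comp (fun i e => e (i + 1)) fun _ => inferInstance)

theorem S1.comp₁ {P : M.Num → Prop} (hP : S1 (fun e => P (e 0)))
    {T : (ℕ → M.Num) → M.Num} [hT : TD T] : S1 (fun e => P (T e)) :=
  hP.comp (fun _ => T) fun _ => hT

theorem S1.comp₂ {P : M.Num → M.Num → Prop} (hP : S1 (fun e => P (e 0) (e 1)))
    {T S : (ℕ → M.Num) → M.Num} [hT : TD T] [hS : TD S] : S1 (fun e => P (T e) (S e)) :=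
  hP.comp (fun i => if i = 0 then T else S) fun i => by split_ifs <;> assumption

theorem S1.comp₃ {P : M.Num → M.Num → M.Num → Prop} (hP : S1 (fun e => P (e 0) (e 1) (e 2)))
    {T S U : (ℕ → M.Num) → M.Num} [hT : TD T] [hS : TD S] [hU : TD U] :
    S1 (fun e => P (T e) (S e) (U e)) :=
  hP.comp (fun i => if i = 0 then T else if i = 1 then S else U)
    fun i => by split_ifs <;> assumption

theorem P1.congr {P Q : (ℕ → M.Num) → Prop} (hQ : P1 Q) (h : ∀ e, P e ↔ Q e) : P1 P := by
  rwa [show P = Q from funext fun e => propext (h e)]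

variable [hM : Fact M.IsModelRCA0]

/-! ## The ordered semiring of numbers -/

theorem ex_induction {Q : M.Num → M.Num → Prop} (hQ : D0 (fun e => Q (e 0) (e 1)))
    (h0 : ∃ x, Q x 0) (hs : ∀ a, (∃ x, Q x a) → ∃ x, Q x (a + 1)) (a : M.Num) : ∃ x, Q x a := by
  obtain ⟨A, -, hA, -, c, E, h, -⟩ := hQ.forms hQ
  have := hM.out.sigma1_induction (.ex A) ⟨A, hA, rfl⟩ c E
  simp only [Sat, ← h] at this
  exact this h0 hs a

theorem d0_induction {P : M.Num → Prop} (hP : D0 (fun e => P (e 0)))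
    (h0 : P 0) (hs : ∀ a, P a → P (a + 1)) (a : M.Num) : P a := by
  have := ex_induction (M := M) (Q := fun _ a => P a) hP.comp₁ ⟨0, h0⟩
    fun a ⟨_, h⟩ => ⟨0, hs a h⟩
  exact (this a).choose_spec

theorem num_add_zero (a : M.Num) : a + 0 = a := hM.out.add_zero a

theorem num_add_succ (a b : M.Num) : a + (b + 1) = a + b + 1 := hM.out.add_succ a b

theorem num_mul_zero (a : M.Num) : a * 0 = 0 := hM.out.mul_zero a

theorem num_mul_succ (a b : M.Num) : a * (b + 1) = a * b + a := hM.out.mul_succ a b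

theorem num_zero_add (a : M.Num) : 0 + a = a :=
  d0_induction (P := fun a => 0 + a = a) inferInstance (num_add_zero 0)
    (fun a h => by rw [num_add_succ, h]) a

theorem num_succ_add (a b : M.Num) : a + 1 + b = a + b + 1 :=
  d0_induction (P := fun b => a + 1 + b = a + b + 1) inferInstance
    (by rw [num_add_zero, num_add_zero])
    (fun b h => by rw [num_add_succ, num_add_succ, h]) b

theorem num_add_comm (a b : M.Num) : a + b = b + a :=
  d0_induction (P := fun b => a + b = b + a) inferInstance
    (by rw [num_add_zero, num_zero_add])
    (fun b h => by rw [num_add_succ, num_succ_add, h]) b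

theorem num_add_assoc (a b c : M.Num) : a + b + c = a + (b + c) :=
  d0_induction (P := fun c => a + b + c = a + (b + c)) inferInstance
    (by rw [num_add_zero, num_add_zero])
    (fun c h => by rw [num_add_succ, num_add_succ, num_add_succ, h]) c

theorem num_zero_mul (a : M.Num) : 0 * a = 0 :=
  d0_induction (P := fun a => 0 * a = 0) inferInstance (num_mul_zero 0)
    (fun a h => by rw [num_mul_succ, h, num_add_zero]) a

theorem num_succ_mul (a b : M.Num) : (a + 1) * b = a * b + b :=
  d0_induction (P := fun b => (a + 1) * b = a * b + b) inferInstance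
    (by rw [num_mul_zero, num_mul_zero, num_add_zero])
    (fun b h => by
      rw [num_mul_succ, num_mul_succ, h, num_add_succ (a * b + b), num_add_succ (a * b + a),
        num_add_assoc (a * b) b a, num_add_comm b a, ← num_add_assoc (a * b) a b]) b

theorem num_mul_comm (a b : M.Num) : a * b = b * a :=
  d0_induction (P := fun b => a * b = b * a) inferInstance
    (by rw [num_mul_zero, num_zero_mul])
    (fun b h => by rw [num_mul_succ, num_succ_mul, h]) b

theorem num_mul_add (a b c : M.Num) : a * (b + c) = a * b + a * c :=
  d0_induction (P := fun c => a * (b + c) = a * b + a * c) inferInstance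
    (by rw [num_mul_zero, num_add_zero, num_add_zero])
    (fun c h => by rw [num_add_succ, num_mul_succ, num_mul_succ, h, num_add_assoc]) c

theorem num_mul_assoc (a b c : M.Num) : a * b * c = a * (b * c) :=
  d0_induction (P := fun c => a * b * c = a * (b * c)) inferInstance
    (by rw [num_mul_zero, num_mul_zero, num_mul_zero])
    (fun c h => by rw [num_mul_succ, num_mul_succ, num_mul_add, h]) c

theorem num_add_right_cancel (a b c : M.Num) : a + c = b + c → a = b :=
  d0_induction (P := fun c => a + c = b + c → a = b) inferInstance
    (by rw [num_add_zero, num_add_zero]; exact id)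
    (fun c h h' => by
      rw [num_add_succ, num_add_succ] at h'
      exact h (hM.out.succ_inj _ _ h')) c

theorem num_zero_or_succ (a : M.Num) : ∃ b, a = 0 ∨ a = b + 1 :=
  ex_induction (Q := fun b a => a = 0 ∨ a = b + 1) inferInstance ⟨0, .inl rfl⟩
    (fun a _ => ⟨a, .inr rfl⟩) a

theorem num_lt_iff (a b : M.Num) : a < b ↔ ∃ c, b = a + c + 1 := by
  constructor
  · intro h
    obtain ⟨c, hc⟩ := ex_induction (M := M) (Q := fun c b => a < b → b = a + c + 1) inferInstance
      ⟨0, fun h => (hM.out.not_lt_zero a h).elim⟩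
      (fun b ⟨c, hc⟩ => by
        by_cases hb : a < b
        · exact ⟨c + 1, fun _ => by rw [num_add_succ, ← hc hb]⟩
        · refine ⟨0, fun h => ?_⟩
          rcases (hM.out.lt_succ a b).1 h with h | h
          · exact absurd h hb
          · rw [num_add_zero, h]) b
    exact ⟨c, hc h⟩
  · rintro ⟨c, rfl⟩
    exact d0_induction (M := M) (P := fun c => a < a + c + 1) inferInstance
      ((hM.out.lt_succ _ _).2 (.inr (num_add_zero a).symm))
      (fun c h => (hM.out.lt_succ _ _).2 (.inl (by rwa [num_add_succ]))) c

theorem num_add_eq_zero {a b : M.Num} (h : a + b = 0) : b = 0 := by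
  obtain ⟨c, hc | hc⟩ := num_zero_or_succ b
  · exact hc
  · rw [hc, num_add_succ] at h
    exact (hM.out.succ_ne_zero _ h).elim

theorem num_total (a b : M.Num) : ∃ c, a = b + c ∨ b = a + c :=
  ex_induction (Q := fun c a => a = b + c ∨ b = a + c) inferInstance
    ⟨b, .inr (num_zero_add b).symm⟩
    (fun a ⟨c, hc⟩ => by
      rcases hc with hc | hc
      · exact ⟨c + 1, .inl (by rw [hc, num_add_succ])⟩
      · obtain ⟨d, hd | hd⟩ := num_zero_or_succ c
        · exact ⟨1, .inl (by rw [hc, hd, num_add_zero])⟩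
        · exact ⟨d, .inr (by rw [hc, hd, num_add_succ, num_succ_add])⟩) a

instance : CommSemiring M.Num where
  add_assoc := num_add_assoc
  zero_add := num_zero_add
  add_zero := num_add_zero
  add_comm := num_add_comm
  left_distrib := num_mul_add
  right_distrib a b c := by rw [num_mul_comm, num_mul_add, num_mul_comm c, num_mul_comm c]
  zero_mul := num_zero_mul
  mul_zero := num_mul_zero
  mul_assoc := num_mul_assoc
  one_mul a := by rw [← num_zero_add 1, num_succ_mul, num_zero_mul, num_zero_add]
  mul_one a := by rw [← num_zero_add 1, num_mul_succ, num_mul_zero, num_zero_add]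
  mul_comm := num_mul_comm
  nsmul := nsmulRec
  npow := npowRec

instance : LE M.Num := ⟨fun a b => a < b ∨ a = b⟩

theorem num_le_iff {a b : M.Num} : a ≤ b ↔ ∃ c, b = a + c := by
  constructor
  · rintro (h | rfl)
    · obtain ⟨c, hc⟩ := (num_lt_iff a b).1 h
      exact ⟨c + 1, by rw [hc, num_add_succ]⟩
    · exact ⟨0, (num_add_zero a).symm⟩
  · rintro ⟨c, rfl⟩
    obtain ⟨d, rfl | rfl⟩ := num_zero_or_succ c
    · exact .inr (num_add_zero a).symm
    · exact .inl ((num_lt_iff _ _).2 ⟨d, num_add_succ a d⟩)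

theorem num_le_antisymm {a b : M.Num} (h : a ≤ b) (h' : b ≤ a) : a = b := by
  obtain ⟨c, rfl⟩ := num_le_iff.1 h
  obtain ⟨d, hd⟩ := num_le_iff.1 h'
  have : c + d = 0 := num_add_right_cancel _ _ a (by
    rw [num_zero_add, num_add_comm, ← num_add_assoc]; exact hd.symm)
  rw [num_add_comm] at this
  rw [num_add_eq_zero this, num_add_zero]

theorem num_lt_irrefl (a : M.Num) : ¬ a < a := fun h => by
  obtain ⟨c, hc⟩ := (num_lt_iff a a).1 h
  refine hM.out.succ_ne_zero c (num_add_right_cancel _ _ a ?_)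
  rw [num_zero_add, num_add_comm, ← num_add_assoc]
  exact hc.symm

noncomputable instance : LinearOrder M.Num where
  le_refl a := .inr rfl
  le_trans a b c h h' := by
    obtain ⟨d, rfl⟩ := num_le_iff.1 h
    obtain ⟨k, rfl⟩ := num_le_iff.1 h'
    exact num_le_iff.2 ⟨d + k, num_add_assoc _ _ _⟩
  le_antisymm a b := num_le_antisymm
  le_total a b := by
    obtain ⟨c, h | h⟩ := num_total a b
    · exact .inr (num_le_iff.2 ⟨c, h⟩)
    · exact .inl (num_le_iff.2 ⟨c, h⟩)
  lt_iff_le_not_ge a b := by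
    constructor
    · intro h
      refine ⟨.inl h, fun h' => ?_⟩
      have := num_le_antisymm (.inl h) h'
      subst this
      exact num_lt_irrefl _ h
    · rintro ⟨h | rfl, h'⟩
      · exact h
      · exact (h' (.inr rfl)).elim
  toDecidableLE := Classical.decRel _

instance : IsStrictOrderedRing M.Num :=
  have hadd : ∀ a b c : M.Num, a ≤ b → a + c ≤ b + c := fun a b c h => by
    obtain ⟨d, rfl⟩ := num_le_iff.1 h
    exact num_le_iff.2 ⟨d, by ring⟩
  have hcancel : ∀ a b c : M.Num, a + b ≤ a + c → b ≤ c := fun a b c h => by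
    obtain ⟨d, hd⟩ := num_le_iff.1 h
    exact num_le_iff.2 ⟨d, num_add_right_cancel _ _ a (by rw [num_add_comm, hd]; ring)⟩
  have hmul : ∀ a b c : M.Num, 0 < c → a < b → a * c < b * c := fun a b c hc h => by
    obtain ⟨d, rfl⟩ := (num_lt_iff _ _).1 h
    obtain ⟨k, rfl⟩ := (num_lt_iff _ _).1 hc
    exact (num_lt_iff _ _).2 ⟨d * k + d + k, by ring⟩
  { add_le_add_left := fun a b h c => hadd a b c h
    le_of_add_le_add_left := hcancel
    zero_le_one := num_le_iff.2 ⟨1, (num_zero_add 1).symm⟩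
    exists_pair_ne := ⟨1, 0, fun h => hM.out.succ_ne_zero 0 (by rw [num_zero_add, h])⟩
    mul_lt_mul_of_pos_left := fun a ha _ _ h => by
      simpa only [mul_comm a] using hmul _ _ _ ha h
    mul_lt_mul_of_pos_right := fun _ ha _ _ h => hmul _ _ _ ha h }

instance : CanonicallyOrderedAdd M.Num where
  exists_add_of_le h := num_le_iff.1 h
  le_self_add _ b := num_le_iff.2 ⟨b, rfl⟩
  le_add_self _ b := num_le_iff.2 ⟨b, add_comm _ _⟩

theorem lt_succ_iff {a b : M.Num} : a < b + 1 ↔ a ≤ b := hM.out.lt_succ a b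

theorem succ_le_iff {a b : M.Num} : a + 1 ≤ b ↔ a < b := by
  rw [num_le_iff, num_lt_iff]
  exact exists_congr fun c => by rw [num_succ_add]

theorem zero_or_succ (a : M.Num) : a = 0 ∨ ∃ b, a = b + 1 := by
  obtain ⟨b, h | h⟩ := num_zero_or_succ a
  · exact .inl h
  · exact .inr ⟨b, h⟩

instance D0.balle {P : M.Num → (ℕ → M.Num) → Prop} {T : (ℕ → M.Num) → M.Num} [TD T]
    [D0 (fun e => P (e 0) (fun i => e (i + 1)))] : D0 (fun e => ∀ x, x ≤ T e → P x e) :=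
  D0.congr (Q := fun e => ∀ x, x < T e + 1 → P x e) inferInstance fun e => by
    simp only [lt_succ_iff]

instance D0.bexe {P : M.Num → (ℕ → M.Num) → Prop} {T : (ℕ → M.Num) → M.Num} [TD T]
    [D0 (fun e => P (e 0) (fun i => e (i + 1)))] : D0 (fun e => ∃ x, x ≤ T e ∧ P x e) :=
  D0.congr (Q := fun e => ∃ x, x < T e + 1 ∧ P x e) inferInstance fun e => by
    simp only [lt_succ_iff]

instance S1.and {P Q : (ℕ → M.Num) → Prop} [hP : S1 P] [hQ : S1 Q] : S1 (fun e => P e ∧ Q e) := by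
  obtain ⟨P', hP', h⟩ := hP.out
  obtain ⟨Q', hQ', h'⟩ := hQ.out
  refine ⟨fun b e => (∃ x, x < b ∧ P' x e) ∧ ∃ x, x < b ∧ Q' x e, ?_, fun e => ?_⟩
  · have h₁ : D0 (fun e : ℕ → M.Num => P' (e 0) (fun i => e (i + 1 + 1))) :=
      hP'.comp (fun i e => SOA.scons (e 0) (fun i => e (i + 1 + 1)) i)
        (TD.scons inferInstance fun _ => inferInstance)
    have h₂ : D0 (fun e : ℕ → M.Num => Q' (e 0) (fun i => e (i + 1 + 1))) :=
      hQ'.comp (fun i e => SOA.scons (e 0) (fun i => e (i + 1 + 1)) i)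
        (TD.scons inferInstance fun _ => inferInstance)
    infer_instance
  · rw [h, h']
    constructor
    · rintro ⟨⟨x, hx⟩, y, hy⟩
      exact ⟨max x y + 1, ⟨x, lt_succ_iff.2 (le_max_left _ _), hx⟩, y,
        lt_succ_iff.2 (le_max_right _ _), hy⟩
    · rintro ⟨b, ⟨x, -, hx⟩, y, -, hy⟩
      exact ⟨⟨x, hx⟩, y, hy⟩

instance S1.or {P Q : (ℕ → M.Num) → Prop} [hP : S1 P] [hQ : S1 Q] : S1 (fun e => P e ∨ Q e) := by
  obtain ⟨P', hP', h⟩ := hP.out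
  obtain ⟨Q', hQ', h'⟩ := hQ.out
  refine ⟨fun b e => P' b e ∨ Q' b e, inferInstance, fun e => ?_⟩
  rw [h, h', exists_or]

instance S1.ex {P : M.Num → (ℕ → M.Num) → Prop} [hP : S1 (fun e => P (e 0) (fun i => e (i + 1)))] :
    S1 (fun e => ∃ x, P x e) := by
  obtain ⟨Q, hQ, h⟩ := hP.out
  refine ⟨fun b e => ∃ x, x < b ∧ ∃ y, y < b ∧ Q y (scons x e), ?_, fun e => ?_⟩
  · have h₁ : D0 (fun e : ℕ → M.Num => Q (e 0) (scons (e (0 + 1)) (fun i => e (i + 1 + 1 + 1)))) :=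
      hQ.comp (fun i e => scons (e 0) (fun i => scons (e (0 + 1)) (fun i => e (i + 1 + 1 + 1)) i) i)
        (TD.scons inferInstance (TD.scons inferInstance fun _ => inferInstance))
    have h₂ : D0 (fun e : ℕ → M.Num =>
        ∃ y, y < e (0 + 1) ∧ Q y (scons (e 0) (fun i => e (i + 1 + 1)))) :=
      D0.bex (P := fun y e => Q y (scons (e 0) (fun i => e (i + 1 + 1))))
        (T := fun e => e (0 + 1)) (hP := h₁)
    exact D0.bex (P := fun x e => ∃ y, y < e 0 ∧ Q y (scons x (fun i => e (i + 1)))) (hP := h₂)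
  · have h' : ∀ x, P x e ↔ ∃ y, Q y (scons x e) := fun x => h (scons x e)
    constructor
    · rintro ⟨x, hx⟩
      obtain ⟨y, hy⟩ := (h' x).1 hx
      exact ⟨max x y + 1, x, lt_succ_iff.2 (le_max_left _ _), y,
        lt_succ_iff.2 (le_max_right _ _), hy⟩
    · rintro ⟨b, x, -, y, -, hy⟩
      exact ⟨x, (h' x).2 ⟨y, hy⟩⟩

instance (priority := low) P1.of_d0 {P : (ℕ → M.Num) → Prop} [D0 P] : P1 P := ⟨inferInstance⟩

instance P1.all {P : M.Num → (ℕ → M.Num) → Prop} [hP : P1 (fun e => P (e 0) (fun i => e (i + 1)))] :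
    P1 (fun e => ∀ x, P x e) :=
  ⟨have := hP.out; S1.congr (Q := fun e => ∃ x, ¬ P x e) inferInstance fun _ => by push Not; rfl⟩

instance P1.imp {P Q : (ℕ → M.Num) → Prop} [hP : S1 P] [hQ : P1 Q] : P1 (fun e => P e → Q e) :=
  ⟨have := hQ.out; S1.congr (Q := fun e => P e ∧ ¬ Q e) inferInstance fun _ => by push Not; rfl⟩

theorem s1_induction {P : M.Num → Prop} (hP : S1 (fun e => P (e 0)))
    (h0 : P 0) (hs : ∀ a, P a → P (a + 1)) (a : M.Num) : P a := by
  obtain ⟨Q, hQ, h⟩ := hP.out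
  have hQ' : D0 (fun e : ℕ → M.Num => Q (e 0) (fun _ => e 1)) :=
    hQ.comp (fun i e => scons (e 0) (fun _ => e 1) i)
      (TD.scons inferInstance fun _ => inferInstance)
  have h' : ∀ a, P a ↔ ∃ x, Q x (fun _ => a) := fun a => h fun _ => a
  rw [h']
  exact ex_induction (Q := fun x a => Q x (fun _ => a)) hQ' ((h' _).1 h0)
    (fun a ha => (h' _).1 (hs a ((h' a).2 ha))) a

instance S1.imp {P Q : (ℕ → M.Num) → Prop} [D0 P] [S1 Q] : S1 (fun e => P e → Q e) :=
  S1.congr (Q := fun e => ¬ P e ∨ Q e) inferInstance fun _ => imp_iff_not_or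

theorem collection {F : M.Num → M.Num → Prop} (hF : S1 (fun e => F (e 0) (e 1))) {l : M.Num}
    (h : ∀ i < l, ∃ x, F i x) : ∃ b, ∀ i < l, ∃ x < b, F i x := by
  obtain ⟨Q, hQ, hFQ⟩ := hF.out
  have h' : ∀ i x, F i x ↔ ∃ y, Q y (scons i fun _ => x) := fun i x => hFQ (scons i fun _ => x)
  have hQ' : D0 (fun e : ℕ → M.Num => Q (e 0) (scons (e 2) fun _ => e 1)) :=
    hQ.comp (fun i e => scons (e 0) (fun i => scons (e 2) (fun _ => e 1) i) i)
      (TD.scons inferInstance (TD.scons inferInstance fun _ => inferInstance))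
  have hQ₂ : ∀ {T S U : (ℕ → M.Num) → M.Num} [TD T] [TD S] [TD U],
      D0 (fun e => Q (T e) (scons (U e) fun _ => S e)) :=
    D0.comp₃ (P := fun y x i => Q y (scons i fun _ => x)) hQ'
  obtain ⟨b, hb⟩ := s1_induction (M := M)
    (P := fun k => ∃ b, ∀ i, i < k → i < l → ∃ x, x < b ∧ ∃ y, y < b ∧ Q y (scons i fun _ => x))
    inferInstance ⟨0, fun i hi => (hM.out.not_lt_zero i hi).elim⟩
    (fun k ⟨b, hb⟩ => by
      by_cases hk : k < l
      · obtain ⟨x, hx⟩ := h k hk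
        obtain ⟨y, hy⟩ := (h' k x).1 hx
        refine ⟨max b (max x y + 1), fun i hi hil => ?_⟩
        rcases lt_succ_iff.1 hi with hi | rfl
        · obtain ⟨x, hx, y, hy, hq⟩ := hb i hi hil
          exact ⟨x, lt_max_of_lt_left hx, y, lt_max_of_lt_left hy, hq⟩
        · exact ⟨x, lt_max_of_lt_right (lt_succ_iff.2 (le_max_left _ _)), y,
            lt_max_of_lt_right (lt_succ_iff.2 (le_max_right _ _)), hy⟩
      · refine ⟨b, fun i hi hil => hb i ?_ hil⟩
        rcases lt_succ_iff.1 hi with hi | rfl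
        · exact hi
        · exact (hk hil).elim) l
  refine ⟨b, fun i hi => ?_⟩
  obtain ⟨x, hx, y, -, hq⟩ := hb i hi hi
  exact ⟨x, hx, (h' i x).2 ⟨y, hq⟩⟩

instance S1.ball {P : M.Num → (ℕ → M.Num) → Prop} {T : (ℕ → M.Num) → M.Num} [hT : TD T]
    [hP : S1 (fun e => P (e 0) (fun i => e (i + 1)))] : S1 (fun e => ∀ x, x < T e → P x e) := by
  obtain ⟨Q, hQ, h⟩ := hP.out
  have h' : ∀ x e, P x e ↔ ∃ y, Q y (scons x e) := fun x e => h (scons x e)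
  refine ⟨fun b e => ∀ x, x < T e → ∃ y, y < b ∧ Q y (scons x e), ?_, fun e => ?_⟩
  · have h₁ : D0 (fun e : ℕ → M.Num => Q (e 0) (scons (e (0 + 1)) (fun i => e (i + 1 + 1 + 1)))) :=
      hQ.comp (fun i e => scons (e 0) (fun i => scons (e (0 + 1)) (fun i => e (i + 1 + 1 + 1)) i) i)
        (TD.scons inferInstance (TD.scons inferInstance fun _ => inferInstance))
    have h₂ : D0 (fun e : ℕ → M.Num =>
        ∃ y, y < e (0 + 1) ∧ Q y (scons (e 0) (fun i => e (i + 1 + 1)))) :=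
      D0.bex (P := fun y e => Q y (scons (e 0) (fun i => e (i + 1 + 1))))
        (T := fun e => e (0 + 1)) (hP := h₁)
    exact D0.ball (P := fun x e => ∃ y, y < e 0 ∧ Q y (scons x (fun i => e (i + 1))))
      (T := fun e => T (fun i => e (i + 1)))
      (hT := hT.comp (fun i e => e (i + 1)) fun _ => inferInstance) (hP := h₂)
  · constructor
    · intro hx
      refine collection (F := fun x y => Q y (scons x e)) (D0.s1 ?_) fun x hxT => (h' x e).1 (hx x hxT)
      exact hQ.comp (fun i e' => scons (e' 1) (fun i => scons (e' 0) (fun i => e i) i) i)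
        (TD.scons inferInstance (TD.scons inferInstance fun _ => inferInstance))
    · rintro ⟨b, hb⟩ x hx
      obtain ⟨y, -, hy⟩ := hb x hx
      exact (h' x e).2 ⟨y, hy⟩

theorem p1_induction {P : M.Num → Prop} (hP : P1 (fun e => P (e 0)))
    (h0 : P 0) (hs : ∀ a, P a → P (a + 1)) (a : M.Num) : P a := by
  by_contra ha
  have hS : ∀ {T : (ℕ → M.Num) → M.Num} [TD T], S1 (fun e => ¬ P (T e)) :=
    S1.comp₁ (P := fun x => ¬ P x) hP.out
  have key := s1_induction (M := M) (P := fun x => ∃ y, (y + x = a ∧ ¬ P y) ∨ a < x) inferInstance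
    ⟨a, .inl ⟨add_zero a, ha⟩⟩
    (fun x ⟨y, hy⟩ => by
      rcases hy with ⟨hy, hP'⟩ | hx
      · rcases zero_or_succ y with rfl | ⟨z, rfl⟩
        · exact ⟨0, .inr (lt_succ_iff.2 (by grind))⟩
        · exact ⟨z, .inl ⟨by grind, fun hz => hP' (hs z hz)⟩⟩
      · exact ⟨0, .inr (hx.trans (lt_add_one x))⟩) a
  obtain ⟨y, ⟨hy, hP'⟩ | h⟩ := key
  · have : y = 0 := by grind
    exact hP' (this ▸ h0)
  · exact lt_irrefl _ h

theorem p1_strong_induction {P : M.Num → Prop} (hP : P1 (fun e => P (e 0)))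
    (hs : ∀ a, (∀ b < a, P b) → P a) (a : M.Num) : P a := by
  have hP' : ∀ {T : (ℕ → M.Num) → M.Num} [TD T], P1 (fun e => P (T e)) :=
    ⟨S1.comp₁ (P := fun x => ¬ P x) hP.out⟩
  have key := p1_induction (M := M) (P := fun a => ∀ b, b < a → P b) inferInstance
    (fun b hb => (hM.out.not_lt_zero b hb).elim)
    (fun a h b hb => by
      rcases lt_succ_iff.1 hb with hb | rfl
      · exact h b hb
      · exact hs _ h) (a + 1)
  exact key a (lt_succ_iff.2 le_rfl)

theorem exists_least {P : M.Num → Prop} (hP : D0 (fun e => P (e 0))) (h : ∃ a, P a) :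
    ∃ a, P a ∧ ∀ b < a, ¬ P b := by
  by_contra hc
  push Not at hc
  obtain ⟨a, ha⟩ := h
  refine p1_strong_induction (P := fun a => ¬ P a) inferInstance (fun a ih ha => ?_) a ha
  obtain ⟨b, hb, hb'⟩ := hc a ha
  exact ih b hb hb'

theorem delta1_comprehension {P : M.Num → Prop} (hS : S1 (fun e => P (e 0)))
    (hP : P1 (fun e => P (e 0))) : ∃ X : M.sets, ∀ a, a ∈ X ↔ P a := by
  obtain ⟨Q, hQ, h⟩ := hS.out
  obtain ⟨Q', hQ', h'⟩ := hP.out.out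
  have hm : ∀ {Q : M.Num → (ℕ → M.Num) → Prop}, D0 (fun e => Q (e 0) (fun i => e (i + 1))) →
      D0 (fun e : ℕ → M.Num => Q (e 0) (fun _ => e 1)) := fun hQ =>
    hQ.comp (fun i e => scons (e 0) (fun _ => e 1) i)
      (TD.scons inferInstance fun _ => inferInstance)
  have hm' := hm hQ'
  obtain ⟨A, B, hA, hB, c, E, hcA, hcB⟩ := 
    (D0.forms (P := fun x a => Q x fun _ => a) (Q := fun x a => ¬ Q' x fun _ => a) (hm hQ)
      inferInstance)
  have hA' : ∀ a, M.Sat (scons a c) E (.ex A) ↔ P a := fun a => by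
    simp only [Sat, ← hcA]
    exact (h fun _ => a).symm
  have hB' : ∀ a, M.Sat (scons a c) E (.all B) ↔ P a := fun a => by
    simp only [Sat, ← hcB]
    rw [← not_iff_not, not_forall]
    simp only [not_not]
    exact (h' fun _ => a).symm
  exact ⟨⟨_, hM.out.delta1_comprehension _ _ ⟨A, hA, rfl⟩ ⟨B, hB, rfl⟩ c E
    fun a => (hA' a).trans (hB' a).symm⟩, hA'⟩

end L2Structure
end SOA

namespace SOA
namespace L2Structure

variable {M : L2Structure.{u}}

/-- `s` codes a sequence of length `l`. -/
def Len (M : L2Structure.{u}) (s l : M.Num) : Prop := ∃ a b, s = pairC (pairC a b) l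

theorem Entry.len {s i x : M.Num} (h : M.Entry s i x) : ∃ l, M.Len s l ∧ i < l :=
  let ⟨a, b, l, _, h, hi, _⟩ := h
  ⟨l, ⟨a, b, h⟩, hi⟩

variable [hM : Fact M.IsModelRCA0]

/-! ## Division, pairs and codes of formulas -/

theorem exists_div (a : M.Num) {m : M.Num} (hm : 0 < m) : ∃ c x, a = c * m + x ∧ x < m :=
  s1_induction (P := fun a => ∃ c x, a = c * m + x ∧ x < m) inferInstance
    ⟨0, 0, by ring, hm⟩
    (fun a ⟨c, x, h, hx⟩ => by
      rcases (succ_le_iff.2 hx).lt_or_eq with h' | h'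
      · exact ⟨c, x + 1, by rw [h]; ring, h'⟩
      · exact ⟨c + 1, 0, by rw [h, ← h']; ring, hm⟩) a

theorem div_unique {m c d x y : M.Num} (h : c * m + x = d * m + y) (hx : x < m) (hy : y < m) :
    c = d ∧ x = y := by
  have key : ∀ {c d x y : M.Num}, c * m + x = d * m + y → x < m → ¬ c < d := by
    intro c d x y h hx hcd
    obtain ⟨k, rfl⟩ := (num_lt_iff _ _).1 hcd
    have h₁ : c * m + x = c * m + (m + (k * m + y)) := by rw [h]; ring
    have h₂ : m ≤ x := num_le_iff.2 ⟨_, add_left_cancel h₁⟩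
    exact absurd hx h₂.not_gt
  have hcd : c = d := le_antisymm (not_lt.1 (key h.symm hy)) (not_lt.1 (key h hx))
  subst hcd
  exact ⟨rfl, add_left_cancel h⟩

theorem le_pairC_left (x y : M.Num) : x ≤ pairC x y :=
  num_le_iff.2 ⟨(x + y) * (x + y) + y + y + y, by unfold pairC; ring⟩

theorem le_pairC_right (x y : M.Num) : y ≤ pairC x y :=
  num_le_iff.2 ⟨(x + y) * (x + y) + x + y + y, by unfold pairC; ring⟩

theorem pairC_inj {x y x' y' : M.Num} (h : pairC x y = pairC x' y') : x = x' ∧ y = y' := by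
  have key : ∀ {x y x' y' : M.Num}, x + y < x' + y' → pairC x y < pairC x' y' := by
    intro x y x' y' h
    obtain ⟨c, hc⟩ := (num_lt_iff _ _).1 h
    refine (num_lt_iff _ _).2 ⟨2 * (x + y) * c + c * c + 3 * c + x + x + 1 + y' + y', ?_⟩
    unfold pairC
    rw [hc]
    ring
  have hs : x + y = x' + y' := le_antisymm (not_lt.1 fun h' => (key h').ne h.symm)
    (not_lt.1 fun h' => (key h').ne h)
  unfold pairC at h
  rw [hs] at h
  have hy : y = y' := by
    have h2 : (0 : M.Num) < 1 + 1 := by norm_num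
    exact mul_left_cancel₀ h2.ne' (add_left_cancel h)
  subst hy
  exact ⟨add_right_cancel hs, rfl⟩

theorem pairC_even (x y : M.Num) : ∃ c, pairC x y = (1 + 1) * c := by
  obtain ⟨d, hd⟩ := s1_induction (P := fun s : M.Num => ∃ d, s * (s + 1) = (1 + 1) * d)
    inferInstance ⟨0, by ring⟩
    (fun s ⟨d, hd⟩ => ⟨d + s + 1, by
      rw [show (s + 1) * (s + 1 + 1) = s * (s + 1) + (1 + 1) * (s + 1) by ring, hd]; ring⟩) (x + y)
  exact ⟨d + y, by unfold pairC; rw [hd]; ring⟩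

theorem exists_pairC (n : M.Num) : ∃ x y, pairC x y = (1 + 1) * n :=
  s1_induction (P := fun n => ∃ x y, pairC x y = (1 + 1) * n) inferInstance
    ⟨0, 0, by unfold pairC; ring⟩
    (fun n ⟨x, y, h⟩ => by
      rw [mul_add, ← h]
      rcases zero_or_succ x with rfl | ⟨x, rfl⟩
      · exact ⟨y + 1, 0, by unfold pairC; ring⟩
      · exact ⟨x, y + 1, by unfold pairC; ring⟩) n

theorem code_cases (n : M.Num) : n = botC ∨ (∃ k, n = varC k) ∨ (∃ k, n = constC k) ∨
    (∃ a, n = boxC a) ∨ ∃ a b, n = impC a b := by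
  obtain ⟨c, x, rfl, hx⟩ := exists_div n (m := 1 + 1 + 1 + 1) (by norm_num)
  rcases lt_succ_iff.1 hx with hx | rfl
  · rcases lt_succ_iff.1 hx with hx | rfl
    · rcases lt_succ_iff.1 hx with hx | rfl
      · have hx : x = 0 := le_antisymm (lt_succ_iff.1 (by rwa [zero_add])) (num_le_iff.2 ⟨x, by ring⟩)
        subst hx
        rcases zero_or_succ c with rfl | ⟨c, rfl⟩
        · exact .inl (by unfold botC; ring)
        · obtain ⟨a, b, h⟩ := exists_pairC c
          exact .inr (.inr (.inr (.inr ⟨a, b, by unfold impC; rw [h]; ring⟩)))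
      · exact .inr (.inl ⟨c, by unfold varC; ring⟩)
    · exact .inr (.inr (.inl ⟨c, by unfold constC; ring⟩))
  · exact .inr (.inr (.inr (.inl ⟨c, by unfold boxC; ring⟩)))

theorem impC_eq (a b : M.Num) :
    ∃ q, pairC a b = (1 + 1) * q ∧ impC a b = (q + 1) * (1 + 1 + 1 + 1) + 0 := by
  obtain ⟨q, hq⟩ := pairC_even a b
  exact ⟨q, hq, by unfold impC; rw [hq]; ring⟩

theorem botC_eq : (botC : M.Num) = 0 * (1 + 1 + 1 + 1) + 0 := by unfold botC; ring

theorem varC_eq (k : M.Num) : varC k = k * (1 + 1 + 1 + 1) + 1 := by unfold varC; ring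

theorem constC_eq (k : M.Num) : constC k = k * (1 + 1 + 1 + 1) + (1 + 1) := by unfold constC; ring

theorem boxC_eq (a : M.Num) : boxC a = a * (1 + 1 + 1 + 1) + (1 + 1 + 1) := by unfold boxC; ring

theorem varC_ne_botC (k : M.Num) : varC k ≠ botC := fun h => by
  rw [varC_eq, botC_eq] at h
  exact absurd (div_unique h (by norm_num) (by norm_num)).2 (by norm_num)

theorem constC_ne_botC (k : M.Num) : constC k ≠ botC := fun h => by
  rw [constC_eq, botC_eq] at h
  exact absurd (div_unique h (by norm_num) (by norm_num)).2 (by norm_num)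

theorem boxC_ne_botC (k : M.Num) : boxC k ≠ botC := fun h => by
  rw [boxC_eq, botC_eq] at h
  exact absurd (div_unique h (by norm_num) (by norm_num)).2 (by norm_num)

theorem impC_ne_botC (a b : M.Num) : impC a b ≠ botC := fun h => by
  obtain ⟨q, -, hq⟩ := impC_eq a b
  rw [hq, botC_eq] at h
  exact absurd (div_unique h (by norm_num) (by norm_num)).1 (hM.out.succ_ne_zero q)

theorem constC_ne_varC (k j : M.Num) : constC k ≠ varC j := fun h => by
  rw [constC_eq, varC_eq] at h
  exact absurd (div_unique h (by norm_num) (by norm_num)).2 (by norm_num)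

theorem boxC_ne_varC (k j : M.Num) : boxC k ≠ varC j := fun h => by
  rw [boxC_eq, varC_eq] at h
  exact absurd (div_unique h (by norm_num) (by norm_num)).2 (by norm_num)

theorem boxC_ne_constC (k j : M.Num) : boxC k ≠ constC j := fun h => by
  rw [boxC_eq, constC_eq] at h
  exact absurd (div_unique h (by norm_num) (by norm_num)).2 (by norm_num)

theorem impC_ne_varC (a b k : M.Num) : impC a b ≠ varC k := fun h => by
  obtain ⟨q, -, hq⟩ := impC_eq a b
  rw [hq, varC_eq] at h
  exact absurd (div_unique h (by norm_num) (by norm_num)).2 (by norm_num)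

theorem impC_ne_constC (a b k : M.Num) : impC a b ≠ constC k := fun h => by
  obtain ⟨q, -, hq⟩ := impC_eq a b
  rw [hq, constC_eq] at h
  exact absurd (div_unique h (by norm_num) (by norm_num)).2 (by norm_num)

theorem impC_ne_boxC (a b k : M.Num) : impC a b ≠ boxC k := fun h => by
  obtain ⟨q, -, hq⟩ := impC_eq a b
  rw [hq, boxC_eq] at h
  exact absurd (div_unique h (by norm_num) (by norm_num)).2 (by norm_num)

theorem varC_inj {k j : M.Num} (h : varC k = varC j) : k = j := by
  rw [varC_eq, varC_eq] at h
  exact (div_unique h (by norm_num) (by norm_num)).1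

theorem boxC_inj {k j : M.Num} (h : boxC k = boxC j) : k = j := by
  rw [boxC_eq, boxC_eq] at h
  exact (div_unique h (by norm_num) (by norm_num)).1

theorem impC_inj {a b c d : M.Num} (h : impC a b = impC c d) : a = c ∧ b = d := by
  obtain ⟨q, hq, h₁⟩ := impC_eq a b
  obtain ⟨r, hr, h₂⟩ := impC_eq c d
  rw [h₁, h₂] at h
  have := add_right_cancel (div_unique h (by norm_num) (by norm_num)).1
  exact pairC_inj (by rw [hq, hr, this])

theorem lt_boxC (a : M.Num) : a < boxC a :=
  (num_lt_iff _ _).2 ⟨3 * a + 2, by unfold boxC; ring⟩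

theorem lt_varC (a : M.Num) : a < varC a :=
  (num_lt_iff _ _).2 ⟨3 * a, by unfold varC; ring⟩

theorem lt_impC_left (a b : M.Num) : a < impC a b := by
  obtain ⟨c, hc⟩ := num_le_iff.1 (le_pairC_left a b)
  refine (num_lt_iff _ _).2 ⟨a + c + c + 3, ?_⟩
  unfold impC
  rw [hc]
  ring

theorem lt_impC_right (a b : M.Num) : b < impC a b := by
  obtain ⟨c, hc⟩ := num_le_iff.1 (le_pairC_right a b)
  refine (num_lt_iff _ _).2 ⟨b + c + c + 3, ?_⟩
  unfold impC
  rw [hc]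
  ring

/-! ## Finite sequences -/

theorem exists_common_multiple (l m : M.Num) :
    ∃ b, m ≤ b ∧ ∀ i < l, ∃ c, b = (i + 1) * c :=
  s1_induction (P := fun l => ∃ b, m ≤ b ∧ ∀ i, i < l → ∃ c, b = (i + 1) * c) inferInstance
    ⟨m, le_rfl, fun i hi => (hM.out.not_lt_zero i hi).elim⟩
    (fun l ⟨b, hb, h⟩ => by
      refine ⟨b * (l + 1), hb.trans (num_le_iff.2 ⟨b * l, by ring⟩), fun i hi => ?_⟩
      rcases lt_succ_iff.1 hi with hi | rfl
      · obtain ⟨c, hc⟩ := h i hi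
        exact ⟨c * (l + 1), by rw [hc]; ring⟩
      · exact ⟨b, by ring⟩) l

theorem exists_inverse {b l j k : M.Num} (hb : 0 < b) (hd : ∀ i < l, ∃ c, b = (i + 1) * c)
    (hjk : j < k) (hk : k < l) :
    ∃ u v, u * (1 + (j + 1) * b) = v * (1 + (k + 1) * b) + 1 := by
  obtain ⟨d, rfl⟩ := (num_lt_iff _ _).1 hjk
  obtain ⟨c, hc⟩ := hd d (lt_of_le_of_lt (num_le_iff.2 ⟨j + 1, by ring⟩) hk)
  have hc0 : c ≠ 0 := by rintro rfl; rw [mul_zero] at hc; exact hb.ne' hc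
  obtain ⟨c, rfl⟩ := (zero_or_succ c).resolve_left hc0
  set k := j + d + 1 with hkd
  set m := 1 + (k + 1) * b with hm
  set n := 1 + (j + 1) * b with hn
  set w := (c + 1) * (k + 1) * (k + 1) with hw
  have h₁ : (k + 1) * n = (j + 1) * m + (d + 1) := by rw [hn, hm, hkd]; ring
  have h₂ : w * n + 1 = ((c + 1) * (k + 1) * (j + 1) + 1) * m := by
    calc w * n + 1 = (c + 1) * (k + 1) * ((k + 1) * n) + 1 := by rw [hw]; ring
      _ = (c + 1) * (k + 1) * (j + 1) * m + (1 + (k + 1) * ((d + 1) * (c + 1))) := by rw [h₁]; ring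
      _ = _ := by rw [← hc, ← hm]; ring
  have h₃ : w * n ≠ 0 := by
    have : 0 < w := by rw [hw]; positivity
    have : 0 < n := by rw [hn]; positivity
    positivity
  obtain ⟨y, hy⟩ := (zero_or_succ _).resolve_left h₃
  refine ⟨w * (w * n), y * ((c + 1) * (k + 1) * (j + 1) + 1), ?_⟩
  calc w * (w * n) * n = (w * n) * (w * n) := by ring
    _ = y * (w * n + 1) + 1 := by rw [hy]; ring
    _ = _ := by rw [h₂]; ring

theorem exists_remainders {F : M.Num → M.Num → Prop} (hF : S1 (fun e => F (e 0) (e 1)))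
    {b l : M.Num} (hb : 0 < b) (hd : ∀ i < l, ∃ c, b = (i + 1) * c)
    (hx : ∀ i < l, ∃ x ≤ b, F i x) :
    ∃ a, ∀ i < l, ∃ x, x ≤ b ∧ F i x ∧ ∃ c, a = c * (1 + (i + 1) * b) + x := by
  have hF' : ∀ {T S : (ℕ → M.Num) → M.Num} [TD T] [TD S], S1 (fun e => F (T e) (S e)) := hF.comp₂
  have key := s1_induction (M := M) (P := fun j => ∃ a p,
      (∀ i, i < j → i < l → ∃ x, x ≤ b ∧ F i x ∧ ∃ c, a = c * (1 + (i + 1) * b) + x) ∧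
      (∀ i, i < j → ∃ q, p = q * (1 + (i + 1) * b)) ∧
      ∀ k, k < l → k < j ∨ ∃ u v, u * p = v * (1 + (k + 1) * b) + 1) inferInstance
    ⟨0, 1, fun i hi => (hM.out.not_lt_zero i hi).elim, fun i hi => (hM.out.not_lt_zero i hi).elim,
      fun k _ => .inr ⟨1, 0, by ring⟩⟩
    (fun j ⟨a, p, h₁, h₂, h₃⟩ => by
      by_cases hj : j < l
      swap
      · refine ⟨a, p * (1 + (j + 1) * b), fun i hi hil => h₁ i (lt_of_lt_of_le hil (not_lt.1 hj)) hil,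
          fun i hi => ?_, fun k hk => .inl
            (lt_of_lt_of_le hk ((not_lt.1 hj).trans (num_le_iff.2 ⟨1, rfl⟩)))⟩
        rcases lt_succ_iff.1 hi with hi | rfl
        · obtain ⟨q, hq⟩ := h₂ i hi
          exact ⟨q * (1 + (j + 1) * b), by rw [hq]; ring⟩
        · exact ⟨p, rfl⟩
      obtain ⟨u, v, huv⟩ := (h₃ j hj).resolve_left (lt_irrefl j)
      obtain ⟨x, hxb, hFx⟩ := hx j hj
      refine ⟨a + p * (u * (x + a * ((j + 1) * b))), p * (1 + (j + 1) * b), fun i hi hil => ?_,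
        fun i hi => ?_, fun k hk => ?_⟩
      · rcases lt_succ_iff.1 hi with hi | rfl
        · obtain ⟨y, hy, hFy, c, hc⟩ := h₁ i hi hil
          obtain ⟨q, hq⟩ := h₂ i hi
          refine ⟨y, hy, hFy, c + q * (u * (x + a * ((j + 1) * b))), ?_⟩
          nth_rewrite 1 [hc]
          rw [hq]
          ring
        · refine ⟨x, hxb, hFx, v * (x + a * ((i + 1) * b)) + a, ?_⟩
          rw [show p * (u * (x + a * ((i + 1) * b))) = (u * p) * (x + a * ((i + 1) * b)) by ring, huv]
          ring
      · rcases lt_succ_iff.1 hi with hi | rfl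
        · obtain ⟨q, hq⟩ := h₂ i hi
          exact ⟨q * (1 + (j + 1) * b), by rw [hq]; ring⟩
        · exact ⟨p, rfl⟩
      · rcases lt_or_ge k (j + 1) with hkj | hkj
        · exact .inl hkj
        · have hjk : j < k := succ_le_iff.1 hkj
          obtain ⟨u, v, h⟩ := (h₃ k hk).resolve_left hjk.not_gt
          obtain ⟨u', v', h'⟩ := exists_inverse hb hd hjk hk
          refine .inr ⟨u * u', v * v' * (1 + (k + 1) * b) + v + v', ?_⟩
          rw [show u * u' * (p * (1 + (j + 1) * b)) = (u * p) * (u' * (1 + (j + 1) * b)) by ring,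
            h, h']
          ring) l
  obtain ⟨a, p, h, -⟩ := key
  exact ⟨a, fun i hi => h i hi hi⟩

instance D0.len {T S : (ℕ → M.Num) → M.Num} [TD T] [TD S] : D0 (fun e => M.Len (T e) (S e)) :=
  D0.comp₂ <| D0.congr
    (Q := fun e : ℕ → M.Num => ∃ a, a ≤ e 0 ∧ ∃ b, b ≤ e 0 ∧ e 0 = pairC (pairC a b) (e 1))
    inferInstance fun _ =>
    ⟨fun ⟨a, b, h⟩ => ⟨a, h ▸ (le_pairC_left _ _).trans (le_pairC_left _ _), b,
      h ▸ (le_pairC_right _ _).trans (le_pairC_left _ _), h⟩,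
      fun ⟨a, _, b, _, h⟩ => ⟨a, b, h⟩⟩

theorem le_div {a c m x : M.Num} (h : a = c * (1 + m) + x) : c ≤ a :=
  num_le_iff.2 ⟨c * m + x, by rw [h]; ring⟩

instance D0.entry {T S U : (ℕ → M.Num) → M.Num} [TD T] [TD S] [TD U] :
    D0 (fun e => M.Entry (T e) (S e) (U e)) :=
  D0.comp₃ <| D0.congr
    (Q := fun e : ℕ → M.Num => ∃ a, a ≤ e 0 ∧ ∃ b, b ≤ e 0 ∧ ∃ l, l ≤ e 0 ∧ ∃ c, c ≤ e 0 ∧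
      e 0 = pairC (pairC a b) l ∧ e 1 < l ∧ a = c * (1 + (e 1 + 1) * b) + e 2 ∧
      e 2 < 1 + (e 1 + 1) * b)
    inferInstance fun e =>
    ⟨fun ⟨a, b, l, c, h, h₁, h₂, h₃⟩ =>
      have ha : a ≤ e 0 := h ▸ (le_pairC_left _ _).trans (le_pairC_left _ _)
      ⟨a, ha, b, h ▸ (le_pairC_right _ _).trans (le_pairC_left _ _), l, h ▸ le_pairC_right _ _, c,
        (le_div h₂).trans ha, h, h₁, h₂, h₃⟩,
      fun ⟨a, _, b, _, l, _, c, _, h⟩ => ⟨a, b, l, c, h⟩⟩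

theorem Len.unique {s l l' : M.Num} (h : M.Len s l) (h' : M.Len s l') : l = l' := by
  obtain ⟨a, b, rfl⟩ := h
  obtain ⟨a', b', h⟩ := h'
  exact (pairC_inj h).2

theorem Entry.lt {s i x l : M.Num} (h : M.Entry s i x) (hl : M.Len s l) : i < l := by
  obtain ⟨l', hl', hi⟩ := h.len
  rwa [hl.unique hl']

theorem Entry.le {s i x : M.Num} (h : M.Entry s i x) : x ≤ s := by
  obtain ⟨a, b, l, c, rfl, -, h, -⟩ := h
  have : x ≤ a := num_le_iff.2 ⟨c * (1 + (i + 1) * b), by rw [h]; ring⟩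
  exact this.trans ((le_pairC_left _ _).trans (le_pairC_left _ _))

theorem Entry.unique {s i x y : M.Num} (hx : M.Entry s i x) (hy : M.Entry s i y) : x = y := by
  obtain ⟨a, b, l, c, rfl, -, h₁, h₂⟩ := hx
  obtain ⟨a', b', l', c', h, -, h₃, h₄⟩ := hy
  obtain ⟨rfl, rfl⟩ := pairC_inj (pairC_inj h).1
  exact (div_unique (h₁.symm.trans h₃) h₂ h₄).2

theorem Len.exists_entry {s l i : M.Num} (h : M.Len s l) (hi : i < l) : ∃ x, M.Entry s i x := by
  obtain ⟨a, b, rfl⟩ := h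
  obtain ⟨c, x, h, hx⟩ := exists_div a (m := 1 + (i + 1) * b) (by positivity)
  exact ⟨x, a, b, l, c, rfl, hi, h, hx⟩

theorem exists_seq {F : M.Num → M.Num → Prop} (hF : S1 (fun e => F (e 0) (e 1))) {l : M.Num}
    (h : ∀ i < l, ∃ x, F i x) : ∃ s, M.Len s l ∧ ∀ i x, M.Entry s i x → F i x := by
  obtain ⟨m, hm⟩ := collection hF h
  obtain ⟨b, hb, hd⟩ := exists_common_multiple l (m + 1)
  have hmb : m < b := succ_le_iff.1 hb
  obtain ⟨a, ha⟩ := exists_remainders hF (lt_of_le_of_lt (zero_le) hmb) hd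
    fun i hi => let ⟨x, hx, hx'⟩ := hm i hi; ⟨x, (hx.trans hmb).le, hx'⟩
  refine ⟨pairC (pairC a b) l, ⟨a, b, rfl⟩, fun i x hx => ?_⟩
  obtain ⟨a', b', l', c, h, hi, h₁, h₂⟩ := hx
  obtain ⟨h', rfl⟩ := pairC_inj h
  obtain ⟨rfl, rfl⟩ := pairC_inj h'
  obtain ⟨y, hy, hF, d, h₃⟩ := ha i hi
  have hy' : y < 1 + (i + 1) * b := by
    rw [add_comm]
    exact lt_succ_iff.2 (hy.trans (num_le_iff.2 ⟨i * b, by ring⟩))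
  rwa [(div_unique (h₁.symm.trans h₃) h₂ hy').2]

theorem exists_append {s l : M.Num} (hs : M.Len s l) (x : M.Num) :
    ∃ t, M.Len t (l + 1) ∧ M.Entry t l x ∧ ∀ i < l, ∀ y, M.Entry t i y ↔ M.Entry s i y := by
  obtain ⟨t, ht, h⟩ := exists_seq (M := M) (F := fun i y => M.Entry s i y ∨ (i = l ∧ y = x))
    inferInstance (l := l + 1) fun i hi => by
      rcases lt_succ_iff.1 hi with hi | rfl
      · obtain ⟨y, hy⟩ := hs.exists_entry hi
        exact ⟨y, .inl hy⟩
      · exact ⟨x, .inr ⟨rfl, rfl⟩⟩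
  have hlt : ∀ i < l, ∀ y, M.Entry t i y → M.Entry s i y := fun i hi y hy =>
    (h i y hy).resolve_right fun h => hi.ne h.1
  refine ⟨t, ht, ?_, fun i hi y => ⟨hlt i hi y, fun hy => ?_⟩⟩
  · obtain ⟨y, hy⟩ := ht.exists_entry (i := l) (lt_succ_iff.2 le_rfl)
    rcases h l y hy with h | ⟨-, rfl⟩
    · exact absurd (h.lt hs) (lt_irrefl _)
    · exact hy
  · obtain ⟨z, hz⟩ := ht.exists_entry (i := i) (hi.trans (lt_succ_iff.2 le_rfl))
    rwa [hy.unique (hlt i hi z hz)]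

end L2Structure
end SOA

namespace SOA
namespace L2Structure

variable {M : L2Structure.{u}}

/-- `t` lists values of the uniform substitution for `σ`, as prescribed by the recursion clauses. -/
def IsComp (M : L2Structure.{u}) (σ t : M.Num) : Prop :=
  ∀ n x, M.Entry t n x → M.SubstStep σ t n x

/-! ## Uniform substitution -/

theorem Subst.bot {σ x : M.Num} (h : M.Subst σ botC x) : x = botC := by
  obtain ⟨t, h, hc⟩ := h
  exact (hc _ _ h).1 rfl

theorem Subst.var_some {σ k x y : M.Num} (h : M.Subst σ (varC k) x) (hy : M.FunVal σ k y) :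
    x = y := by
  obtain ⟨t, h, hc⟩ := h
  exact ((hc _ _ h).2.1 k rfl).1 y hy

theorem Subst.var_none {σ k x : M.Num} (h : M.Subst σ (varC k) x) (hk : ¬ ∃ y, M.FunVal σ k y) :
    x = varC k := by
  obtain ⟨t, h, hc⟩ := h
  exact ((hc _ _ h).2.1 k rfl).2 hk

theorem Subst.const {σ k x : M.Num} (h : M.Subst σ (constC k) x) : x = constC k := by
  obtain ⟨t, h, hc⟩ := h
  exact (hc _ _ h).2.2.1 k rfl

variable [hM : Fact M.IsModelRCA0]

theorem FunVal.le {σ k x : M.Num} (h : M.FunVal σ k x) : x ≤ σ := by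
  obtain ⟨y, hy, rfl⟩ := h
  exact le_trans (num_le_iff.2 ⟨1, rfl⟩) hy.le

theorem FunVal.unique {σ k x y : M.Num} (hx : M.FunVal σ k x) (hy : M.FunVal σ k y) : x = y := by
  obtain ⟨_, hx, rfl⟩ := hx
  obtain ⟨_, hy, rfl⟩ := hy
  exact add_right_cancel (hx.unique hy)

theorem Entry.index_le {s i x : M.Num} (h : M.Entry s i x) : i ≤ s := by
  obtain ⟨l, ⟨a, b, rfl⟩, hi⟩ := h.len
  exact hi.le.trans (le_pairC_right _ _)

instance D0.funVal {T S U : (ℕ → M.Num) → M.Num} [TD T] [TD S] [TD U] :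
    D0 (fun e => M.FunVal (T e) (S e) (U e)) :=
  D0.comp₃ <| D0.congr
    (Q := fun e : ℕ → M.Num => ∃ y, y ≤ e 0 ∧ M.Entry (e 0) (e 1) y ∧ y = e 2 + 1)
    inferInstance fun _ => ⟨fun ⟨y, h, h'⟩ => ⟨y, h.le, h, h'⟩, fun ⟨y, _, h⟩ => ⟨y, h⟩⟩

instance D0.substStep {T S U X : (ℕ → M.Num) → M.Num} [TD T] [TD S] [TD U] [TD X] :
    D0 (fun e => M.SubstStep (T e) (S e) (U e) (X e)) :=
  D0.comp₄ <| D0.congr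
    (Q := fun e : ℕ → M.Num => (e 2 = botC → e 3 = botC) ∧
      (∀ k, k < e 2 → e 2 = varC k → (∀ y, y ≤ e 0 → M.FunVal (e 0) k y → e 3 = y) ∧
        ((¬ ∃ y, y ≤ e 0 ∧ M.FunVal (e 0) k y) → e 3 = e 2)) ∧
      (∀ k, k ≤ e 2 → e 2 = constC k → e 3 = e 2) ∧
      (∀ a, a < e 2 → ∀ y, y ≤ e 1 → e 2 = boxC a → M.Entry (e 1) a y → e 3 = boxC y) ∧
      (∀ a, a < e 2 → ∀ b, b < e 2 → ∀ y, y ≤ e 1 → ∀ z, z ≤ e 1 →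
        e 2 = impC a b → M.Entry (e 1) a y → M.Entry (e 1) b z → e 3 = impC y z))
    inferInstance fun e => by
      refine and_congr Iff.rfl (and_congr ⟨fun h k _ hk => ⟨fun y _ => (h k hk).1 y, fun hn =>
        (h k hk).2 fun ⟨y, hy⟩ => hn ⟨y, hy.le, hy⟩⟩, fun h k hk => ?_⟩ (and_congr ⟨fun h k _ => h k,
        fun h k hk => h k (hk ▸ num_le_iff.2 ⟨3 * k + 2, by unfold constC; ring⟩) hk⟩
        (and_congr ⟨fun h a _ y _ => h a y, fun h a y ha hy => h a (ha ▸ lt_boxC a) y hy.le ha hy⟩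
        ⟨fun h a _ b _ y _ z _ => h a b y z, fun h a b y z hn hy hz => h a (hn ▸ lt_impC_left a b)
          b (hn ▸ lt_impC_right a b) y hy.le z hz.le hn hy hz⟩)))
      obtain ⟨h₁, h₂⟩ := h k (hk ▸ lt_varC k) hk
      exact ⟨fun y hy => h₁ y hy.le hy, fun hn => h₂ fun ⟨y, _, hy⟩ => hn ⟨y, hy⟩⟩

instance D0.isComp {T S : (ℕ → M.Num) → M.Num} [TD T] [TD S] : D0 (fun e => M.IsComp (T e) (S e)) :=
  D0.comp₂ <| D0.congr
    (Q := fun e : ℕ → M.Num => ∀ n, n ≤ e 1 → ∀ x, x ≤ e 1 → M.Entry (e 1) n x →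
      M.SubstStep (e 0) (e 1) n x)
    inferInstance fun _ =>
    ⟨fun h n _ x _ => h n x, fun h n x hx => h n hx.index_le x hx.le hx⟩

instance S1.subst {T S U : (ℕ → M.Num) → M.Num} [TD T] [TD S] [TD U] :
    S1 (fun e => M.Subst (T e) (S e) (U e)) :=
  S1.comp₃ <| S1.congr
    (Q := fun e : ℕ → M.Num => ∃ t, M.Entry t (e 1) (e 2) ∧ M.IsComp (e 0) t)
    inferInstance fun _ => Iff.rfl

theorem SubstStep.congr {σ s t n x : M.Num} (h : M.SubstStep σ s n x)
    (hst : ∀ a < n, ∀ y, M.Entry t a y → M.Entry s a y) : M.SubstStep σ t n x := by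
  obtain ⟨h₁, h₂, h₃, h₄, h₅⟩ := h
  refine ⟨h₁, h₂, h₃, fun a y hn hy => h₄ a y hn (hst a (hn ▸ lt_boxC a) y hy),
    fun a b y z hn hy hz => h₅ a b y z hn (hst a (hn ▸ lt_impC_left a b) y hy)
      (hst b (hn ▸ lt_impC_right a b) z hz)⟩

theorem exists_substStep (σ : M.Num) {t n : M.Num} (ht : M.Len t n) : ∃ x, M.SubstStep σ t n x := by
  rcases code_cases n with rfl | ⟨k, rfl⟩ | ⟨k, rfl⟩ | ⟨a, rfl⟩ | ⟨a, b, rfl⟩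
  · exact ⟨botC, fun _ => rfl, fun k h => (varC_ne_botC k h.symm).elim,
      fun k h => (constC_ne_botC k h.symm).elim, fun a _ h => (boxC_ne_botC a h.symm).elim,
      fun a b _ _ h => (impC_ne_botC a b h.symm).elim⟩
  · obtain ⟨x, hx⟩ : ∃ x, (∀ y, M.FunVal σ k y → x = y) ∧
        ((¬ ∃ y, M.FunVal σ k y) → x = varC k) := by
      by_cases h : ∃ y, M.FunVal σ k y
      · exact ⟨h.choose, fun y hy => h.choose_spec.unique hy, fun h' => (h' h).elim⟩
      · exact ⟨varC k, fun y hy => (h ⟨y, hy⟩).elim, fun _ => rfl⟩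
    refine ⟨x, fun h => (varC_ne_botC k h).elim, fun j hj => ?_,
      fun j h => (constC_ne_varC j k h.symm).elim, fun a _ h => (boxC_ne_varC a k h.symm).elim,
      fun a b _ _ h => (impC_ne_varC a b k h.symm).elim⟩
    rw [← varC_inj hj]
    exact hx
  · exact ⟨constC k, fun h => (constC_ne_botC k h).elim, fun j h => (constC_ne_varC k j h).elim,
      fun _ _ => rfl, fun a _ h => (boxC_ne_constC a k h.symm).elim,
      fun a b _ _ h => (impC_ne_constC a b k h.symm).elim⟩
  · obtain ⟨y, hy⟩ := ht.exists_entry (lt_boxC a)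
    refine ⟨boxC y, fun h => (boxC_ne_botC a h).elim, fun j h => (boxC_ne_varC a j h).elim,
      fun j h => (boxC_ne_constC a j h).elim, fun b z h hz => ?_,
      fun b c _ _ h => (impC_ne_boxC b c a h.symm).elim⟩
    rw [← boxC_inj h] at hz
    rw [hy.unique hz]
  · obtain ⟨y, hy⟩ := ht.exists_entry (lt_impC_left a b)
    obtain ⟨z, hz⟩ := ht.exists_entry (lt_impC_right a b)
    refine ⟨impC y z, fun h => (impC_ne_botC a b h).elim, fun j h => (impC_ne_varC a b j h).elim,
      fun j h => (impC_ne_constC a b j h).elim, fun c _ h => (impC_ne_boxC a b c h).elim,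
      fun c d y' z' h hy' hz' => ?_⟩
    obtain ⟨rfl, rfl⟩ := impC_inj h
    rw [hy.unique hy', hz.unique hz']

theorem exists_isComp (σ l : M.Num) : ∃ t, M.Len t l ∧ M.IsComp σ t :=
  s1_induction (P := fun l => ∃ t, M.Len t l ∧ M.IsComp σ t) inferInstance
    ⟨pairC (pairC 0 0) 0, ⟨0, 0, rfl⟩, fun n x h =>
      (hM.out.not_lt_zero n (h.lt ⟨0, 0, rfl⟩)).elim⟩
    (fun l ⟨t, ht, hc⟩ => by
      obtain ⟨x, hx⟩ := exists_substStep σ ht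
      obtain ⟨s, hs, hsx, hst⟩ := exists_append ht x
      refine ⟨s, hs, fun n y hy => ?_⟩
      rcases lt_succ_iff.1 (hy.lt hs) with hn | rfl
      · exact (hc n y ((hst n hn y).1 hy)).congr fun a ha z => (hst a (ha.trans hn) z).1
      · rw [← hsx.unique hy]
        exact hx.congr fun a ha z => (hst a ha z).1) l

theorem exists_subst (σ φ : M.Num) : ∃ ψ, M.Subst σ φ ψ := by
  obtain ⟨t, ht, hc⟩ := exists_isComp σ (φ + 1)
  obtain ⟨ψ, h⟩ := ht.exists_entry (i := φ) (lt_succ_iff.2 le_rfl)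
  exact ⟨ψ, t, h, hc⟩

theorem Subst.box_inv {σ a x : M.Num} (h : M.Subst σ (boxC a) x) :
    ∃ y, M.Subst σ a y ∧ x = boxC y := by
  obtain ⟨t, h, hc⟩ := h
  obtain ⟨l, hl, hn⟩ := h.len
  obtain ⟨y, hy⟩ := hl.exists_entry ((lt_boxC a).trans hn)
  exact ⟨y, ⟨t, hy, hc⟩, (hc _ _ h).2.2.2.1 a y rfl hy⟩

theorem Subst.imp_inv {σ a b x : M.Num} (h : M.Subst σ (impC a b) x) :
    ∃ y z, M.Subst σ a y ∧ M.Subst σ b z ∧ x = impC y z := by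
  obtain ⟨t, h, hc⟩ := h
  obtain ⟨l, hl, hn⟩ := h.len
  obtain ⟨y, hy⟩ := hl.exists_entry ((lt_impC_left a b).trans hn)
  obtain ⟨z, hz⟩ := hl.exists_entry ((lt_impC_right a b).trans hn)
  exact ⟨y, z, ⟨t, hy, hc⟩, ⟨t, hz, hc⟩, (hc _ _ h).2.2.2.2 a b y z rfl hy hz⟩

theorem Subst.unique {σ φ x y : M.Num} (hx : M.Subst σ φ x) (hy : M.Subst σ φ y) : x = y := by
  refine p1_strong_induction (M := M) (P := fun φ => ∀ x y, M.Subst σ φ x → M.Subst σ φ y → x = y)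
    inferInstance (fun n ih x y hx hy => ?_) φ x y hx hy
  rcases code_cases n with rfl | ⟨k, rfl⟩ | ⟨k, rfl⟩ | ⟨a, rfl⟩ | ⟨a, b, rfl⟩
  · rw [hx.bot, hy.bot]
  · by_cases h : ∃ z, M.FunVal σ k z
    · rw [hx.var_some h.choose_spec, hy.var_some h.choose_spec]
    · rw [hx.var_none h, hy.var_none h]
  · rw [hx.const, hy.const]
  · obtain ⟨x, hx₁, rfl⟩ := hx.box_inv
    obtain ⟨y, hy₁, rfl⟩ := hy.box_inv
    rw [ih a (lt_boxC a) x y hx₁ hy₁]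
  · obtain ⟨x, x', hx₁, hx₂, rfl⟩ := hx.imp_inv
    obtain ⟨y, y', hy₁, hy₂, rfl⟩ := hy.imp_inv
    rw [ih a (lt_impC_left a b) x y hx₁ hy₁, ih b (lt_impC_right a b) x' y' hx₂ hy₂]

theorem subst_bot (σ : M.Num) : M.Subst σ botC botC := by
  obtain ⟨x, hx⟩ := exists_subst σ (botC : M.Num)
  rwa [hx.bot] at hx

theorem Subst.box {σ a y : M.Num} (h : M.Subst σ a y) : M.Subst σ (boxC a) (boxC y) := by
  obtain ⟨x, hx⟩ := exists_subst σ (boxC a)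
  obtain ⟨z, hz, rfl⟩ := hx.box_inv
  rwa [h.unique hz]

theorem Subst.imp {σ a b y z : M.Num} (h : M.Subst σ a y) (h' : M.Subst σ b z) :
    M.Subst σ (impC a b) (impC y z) := by
  obtain ⟨x, hx⟩ := exists_subst σ (impC a b)
  obtain ⟨v, w, hv, hw, rfl⟩ := hx.imp_inv
  rwa [h.unique hv, h'.unique hw]

theorem Subst.neg {σ a y : M.Num} (h : M.Subst σ a y) : M.Subst σ (negC a) (negC y) :=
  h.imp (subst_bot σ)

theorem Subst.dia {σ a y : M.Num} (h : M.Subst σ a y) : M.Subst σ (diaC a) (diaC y) :=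
  h.neg.box.neg

/-- The substitution for the empty function is the identity. -/
theorem Subst.empty {φ x : M.Num} (h : M.Subst (pairC (pairC 0 0) 0) φ x) : x = φ := by
  refine p1_strong_induction (M := M)
    (P := fun φ => ∀ x, M.Subst (pairC (pairC 0 0) 0) φ x → x = φ)
    inferInstance (fun n ih x hx => ?_) φ x h
  rcases code_cases n with rfl | ⟨k, rfl⟩ | ⟨k, rfl⟩ | ⟨a, rfl⟩ | ⟨a, b, rfl⟩
  · exact hx.bot
  · exact hx.var_none fun ⟨_, _, h, _⟩ => hM.out.not_lt_zero k (h.lt ⟨0, 0, rfl⟩)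
  · exact hx.const
  · obtain ⟨x, hx₁, rfl⟩ := hx.box_inv
    rw [ih a (lt_boxC a) x hx₁]
  · obtain ⟨x, x', hx₁, hx₂, rfl⟩ := hx.imp_inv
    rw [ih a (lt_impC_left a b) x hx₁, ih b (lt_impC_right a b) x' hx₂]

/-- The composition of two substitutions, on formulas below a given bound. -/
theorem exists_subst_comp (σ τ N : M.Num) :
    ∃ ρ, ∀ φ < N, ∀ x y, M.Subst σ φ x → M.Subst τ x y → M.Subst ρ φ y := by
  obtain ⟨t, ht, hc⟩ := exists_isComp τ (σ + 1)
  obtain ⟨ρ, hρ, hF⟩ := exists_seq (M := M) (l := N)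
    (F := fun k z => (∃ v, M.FunVal σ k v ∧ ∃ y, M.Entry t v y ∧ z = y + 1) ∨
      (¬ ∃ v, v ≤ σ ∧ M.FunVal σ k v) ∧ ((∃ v, M.FunVal τ k v ∧ z = v + 1) ∨
        (¬ ∃ v, v ≤ τ ∧ M.FunVal τ k v) ∧ z = 0)) inferInstance fun k _ => by
      by_cases h : ∃ v, M.FunVal σ k v
      · obtain ⟨v, hv⟩ := h
        obtain ⟨y, hy⟩ := ht.exists_entry (lt_succ_iff.2 hv.le)
        exact ⟨y + 1, .inl ⟨v, hv, y, hy, rfl⟩⟩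
      · by_cases h' : ∃ v, M.FunVal τ k v
        · obtain ⟨v, hv⟩ := h'
          exact ⟨v + 1, .inr ⟨fun ⟨v, _, hv⟩ => h ⟨v, hv⟩, .inl ⟨v, hv, rfl⟩⟩⟩
        · exact ⟨0, .inr ⟨fun ⟨v, _, hv⟩ => h ⟨v, hv⟩, .inr ⟨fun ⟨v, _, hv⟩ => h' ⟨v, hv⟩, rfl⟩⟩⟩
  have key := p1_strong_induction (M := M) (P := fun φ => ∀ x y z, φ < N → M.Subst σ φ x →
    M.Subst τ x y → M.Subst ρ φ z → z = y) inferInstance (fun n ih x y z hn hx hy hz => by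
      rcases code_cases n with rfl | ⟨k, rfl⟩ | ⟨k, rfl⟩ | ⟨a, rfl⟩ | ⟨a, b, rfl⟩
      · rw [hx.bot] at hy
        rw [hz.bot, hy.bot]
      · obtain ⟨w, hw⟩ := hρ.exists_entry ((lt_varC k).trans hn)
        rcases hF k w hw with ⟨v, hv, y', hy', rfl⟩ | ⟨h, ⟨v, hv, rfl⟩ | ⟨h', rfl⟩⟩
        · rw [hx.var_some hv] at hy
          rw [hz.var_some ⟨_, hw, rfl⟩]
          exact Subst.unique ⟨t, hy', hc⟩ hy
        · rw [hx.var_none fun ⟨v, hv⟩ => h ⟨v, hv.le, hv⟩] at hy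
          rw [hz.var_some ⟨_, hw, rfl⟩, hy.var_some hv]
        · rw [hx.var_none fun ⟨v, hv⟩ => h ⟨v, hv.le, hv⟩] at hy
          rw [hy.var_none fun ⟨v, hv⟩ => h' ⟨v, hv.le, hv⟩]
          refine hz.var_none ?_
          rintro ⟨v, _, hv, rfl⟩
          exact hM.out.succ_ne_zero v (hv.unique hw)
      · rw [hx.const] at hy
        rw [hz.const, hy.const]
      · obtain ⟨x, hx₁, rfl⟩ := hx.box_inv
        obtain ⟨y, hy₁, rfl⟩ := hy.box_inv
        obtain ⟨z, hz₁, rfl⟩ := hz.box_inv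
        rw [ih a (lt_boxC a) x y z ((lt_boxC a).trans hn) hx₁ hy₁ hz₁]
      · obtain ⟨x, x', hx₁, hx₂, rfl⟩ := hx.imp_inv
        obtain ⟨y, y', hy₁, hy₂, rfl⟩ := hy.imp_inv
        obtain ⟨z, z', hz₁, hz₂, rfl⟩ := hz.imp_inv
        rw [ih a (lt_impC_left a b) x y z ((lt_impC_left a b).trans hn) hx₁ hy₁ hz₁,
          ih b (lt_impC_right a b) x' y' z' ((lt_impC_right a b).trans hn) hx₂ hy₂ hz₂])
  refine ⟨ρ, fun φ hφ x y hx hy => ?_⟩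
  obtain ⟨z, hz⟩ := exists_subst ρ φ
  rwa [key φ x y z hφ hx hy hz] at hz

end L2Structure
end SOA

namespace SOA
namespace L2Structure

variable {M : L2Structure.{u}}

/-- `s` is a run of length `n + 1` of the relation `G`, starting at `v`. -/
def IsRun (G : M.Num → M.Num → Prop) (v s n : M.Num) : Prop :=
  M.Len s (n + 1) ∧ M.Entry s 0 v ∧
    ∀ i, i < n → ∀ x, x < s + 1 → ∀ y, y < s + 1 → M.Entry s i x → M.Entry s (i + 1) y → G x y

/-- The formula `φ` is true at `w`. -/
def Holds (V : M.sets) (w φ : M.Num) : Prop := pairC (pairC w φ) 1 ∈ V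

theorem IsValuation.holds_box {W R V : M.sets} (hV : M.IsValuation W R V) {w φ : M.Num} (hw : w ∈ W) :
    Holds V w (boxC φ) ↔ ∀ x, x ∈ W → pairC w x ∈ R → Holds V x φ :=
  hV.2.2.2.2.2 w φ hw

variable [hM : Fact M.IsModelRCA0]

/-! ## Iteration of a relation -/

instance D0.isRun {G : M.Num → M.Num → Prop} [hG : D0 (fun e => G (e 0) (e 1))] {v : M.Num}
    {T S : (ℕ → M.Num) → M.Num} [TD T] [TD S] : D0 (fun e => IsRun G v (T e) (S e)) := by
  have hG' : ∀ {T S : (ℕ → M.Num) → M.Num} [TD T] [TD S], D0 (fun e => G (T e) (S e)) := hG.comp₂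
  refine D0.comp₂ (P := fun s n => IsRun G v s n) ?_
  unfold IsRun
  infer_instance

theorem IsRun.step {G : M.Num → M.Num → Prop} {v s n i x y : M.Num} (h : IsRun G v s n)
    (hi : i < n) (hx : M.Entry s i x) (hy : M.Entry s (i + 1) y) : G x y :=
  h.2.2 i hi x (lt_succ_iff.2 hx.le) y (lt_succ_iff.2 hy.le) hx hy

theorem IsRun.exists_entry {G : M.Num → M.Num → Prop} {v s n i : M.Num} (h : IsRun G v s n)
    (hi : i ≤ n) : ∃ x, M.Entry s i x :=
  h.1.exists_entry (lt_succ_iff.2 hi)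

theorem IsRun.mem {G : M.Num → M.Num → Prop} {S : M.Num → Prop}
    (hS : D0 (fun e => S (e 0))) (hG : ∀ x y, G x y → S y) {v s n i x : M.Num} (hv : S v)
    (h : IsRun G v s n) (hi : i ≤ n) (hx : M.Entry s i x) : S x := by
  have hS' : ∀ {T : (ℕ → M.Num) → M.Num} [TD T], D0 (fun e => S (T e)) := hS.comp₁
  refine p1_induction (M := M) (P := fun i => ∀ x, i ≤ n → M.Entry s i x → S x) inferInstance
    (fun x _ hx => hx.unique h.2.1 ▸ hv) (fun i ih x hi hx => ?_) i x hi hx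
  have hin := succ_le_iff.1 hi
  obtain ⟨y, hy⟩ := h.exists_entry hin.le
  exact hG y x (h.step hin hy hx)

theorem IsRun.unique {G : M.Num → M.Num → Prop} (hG : ∀ x y z, G x y → G x z → y = z)
    {v s n t m i x y : M.Num} (hs : IsRun G v s n) (ht : IsRun G v t m) (hin : i ≤ n) (him : i ≤ m)
    (hx : M.Entry s i x) (hy : M.Entry t i y) : x = y := by
  refine p1_induction (M := M) (P := fun i => ∀ x y, i ≤ n → i ≤ m → M.Entry s i x →
    M.Entry t i y → x = y) inferInstance
    (fun x y _ _ hx hy => (hx.unique hs.2.1).trans (ht.2.1.unique hy))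
    (fun i ih x y hin him hx hy => ?_) i x y hin him hx hy
  have hin := succ_le_iff.1 hin
  have him := succ_le_iff.1 him
  obtain ⟨x', hx'⟩ := hs.exists_entry hin.le
  obtain ⟨y', hy'⟩ := ht.exists_entry him.le
  have := ih x' y' hin.le him.le hx' hy'
  subst this
  exact hG _ _ _ (hs.step hin hx' hx) (ht.step him hy' hy)

theorem exists_isRun {G : M.Num → M.Num → Prop} {S : M.Num → Prop}
    (hS : D0 (fun e => S (e 0))) (hGD : D0 (fun e => G (e 0) (e 1))) (hG : ∀ x y, G x y → S y)
    (hGS : ∀ x, S x → ∃ y, G x y) {v : M.Num} (hv : S v) (n : M.Num) : ∃ s, IsRun G v s n := by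
  refine s1_induction (M := M) (P := fun n => ∃ s, IsRun G v s n) inferInstance ?_
    (fun n ⟨s, h⟩ => ?_) n
  · obtain ⟨t, ht, hv, -⟩ := exists_append (M := M) (s := pairC (pairC 0 0) 0) (l := 0)
      ⟨0, 0, rfl⟩ v
    exact ⟨t, ht, hv, fun i hi => (hM.out.not_lt_zero i hi).elim⟩
  · obtain ⟨x, hx⟩ := h.exists_entry le_rfl
    obtain ⟨y, hy⟩ := hGS x (h.mem hS hG hv le_rfl hx)
    obtain ⟨t, ht, hty, hts⟩ := exists_append h.1 y
    refine ⟨t, ht, (hts 0 (lt_of_le_of_lt zero_le (lt_succ_iff.2 le_rfl)) v).2 h.2.1,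
      fun i hi x' _ y' _ hx' hy' => ?_⟩
    have hx' := (hts i hi x').1 hx'
    rcases lt_succ_iff.1 hi with hi | rfl
    · exact h.step hi hx' ((hts (i + 1) (lt_succ_iff.2 (succ_le_iff.2 hi)) y').1 hy')
    · rwa [hx'.unique hx, hy'.unique hty]

theorem exists_iterate_of_functional {G : M.Num → M.Num → Prop} {S : M.Num → Prop}
    (hS : D0 (fun e => S (e 0))) (hGD : D0 (fun e => G (e 0) (e 1))) (hG : ∀ x y, G x y → S y)
    (hGS : ∀ x, S x → ∃ y, G x y) (hGu : ∀ x y z, G x y → G x z → y = z) {v : M.Num} (hv : S v) :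
    ∃ F : M.sets, (∀ z, z ∈ F → ∃ n x, S x ∧ z = pairC n x) ∧ (∀ n, ∃ x, pairC n x ∈ F) ∧
      (∀ n x y, pairC n x ∈ F → pairC n y ∈ F → x = y) ∧
      ∀ n x y, pairC n x ∈ F → pairC (n + 1) y ∈ F → G x y := by
  have hrun := exists_isRun hS hGD hG hGS hv
  obtain ⟨F, hF⟩ := delta1_comprehension (M := M)
    (P := fun z => ∃ s n x, z = pairC n x ∧ IsRun G v s n ∧ M.Entry s n x) inferInstance
    (P1.congr (Q := fun e => ∀ s, ∃ n, n ≤ e 0 ∧ ∃ x, x ≤ e 0 ∧ e 0 = pairC n x ∧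
      (IsRun G v s n → M.Entry s n x)) inferInstance fun e => by
      constructor
      · rintro ⟨s, n, x, hz, hs, hx⟩ t
        refine ⟨n, hz ▸ le_pairC_left _ _, x, hz ▸ le_pairC_right _ _, hz, fun ht => ?_⟩
        obtain ⟨y, hy⟩ := ht.exists_entry le_rfl
        rwa [hs.unique hGu ht le_rfl le_rfl hx hy]
      · intro h
        obtain ⟨n, -, x, -, hz, -⟩ := h 0
        obtain ⟨s, hs⟩ := hrun n
        obtain ⟨n', -, x', -, hz', h'⟩ := h s
        obtain ⟨rfl, rfl⟩ := pairC_inj (hz.symm.trans hz')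
        exact ⟨s, n, x, hz, hs, h' hs⟩)
  have hF' : ∀ n x, pairC n x ∈ F ↔ ∃ s, IsRun G v s n ∧ M.Entry s n x := by
    intro n x
    rw [hF]
    constructor
    · rintro ⟨s, n', x', h, hs⟩
      obtain ⟨rfl, rfl⟩ := pairC_inj h
      exact ⟨s, hs⟩
    · rintro ⟨s, hs⟩
      exact ⟨s, n, x, rfl, hs⟩
  refine ⟨F, fun z hz => ?_, fun n => ?_, fun n x y hx hy => ?_, fun n x y hx hy => ?_⟩
  · obtain ⟨s, n, x, rfl, hs, hx⟩ := (hF z).1 hz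
    exact ⟨n, x, hs.mem hS hG hv le_rfl hx, rfl⟩
  · obtain ⟨s, hs⟩ := hrun n
    obtain ⟨x, hx⟩ := hs.exists_entry le_rfl
    exact ⟨x, (hF' n x).2 ⟨s, hs, hx⟩⟩
  · obtain ⟨s, hs, hx⟩ := (hF' n x).1 hx
    obtain ⟨t, ht, hy⟩ := (hF' n y).1 hy
    exact hs.unique hGu ht le_rfl le_rfl hx hy
  · obtain ⟨s, hs, hx⟩ := (hF' n x).1 hx
    obtain ⟨t, ht, hy⟩ := (hF' (n + 1) y).1 hy
    have hn : n < n + 1 := lt_succ_iff.2 le_rfl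
    obtain ⟨x', hx'⟩ := ht.exists_entry hn.le
    rw [hs.unique hGu ht le_rfl hn.le hx hx']
    exact ht.step hn hx' hy

/-- If every element of a nonempty `S` is `G`-related to an element of `S`, some sequence of
elements of `S` steps along `G`. -/
theorem exists_iterate {G : M.Num → M.Num → Prop} {S : M.Num → Prop}
    (hS : D0 (fun e => S (e 0))) (hG : D0 (fun e => G (e 0) (e 1)))
    (hGS : ∀ x, S x → ∃ y, G x y ∧ S y) {v : M.Num} (hv : S v) :
    ∃ F : M.sets, (∀ z, z ∈ F → ∃ n x, S x ∧ z = pairC n x) ∧ (∀ n, ∃ x, pairC n x ∈ F) ∧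
      (∀ n x y, pairC n x ∈ F → pairC n y ∈ F → x = y) ∧
      ∀ n x y, pairC n x ∈ F → pairC (n + 1) y ∈ F → G x y := by
  have hS' : ∀ {T : (ℕ → M.Num) → M.Num} [TD T], D0 (fun e => S (T e)) := hS.comp₁
  have hG' : ∀ {T S : (ℕ → M.Num) → M.Num} [TD T] [TD S], D0 (fun e => G (T e) (S e)) := hG.comp₂
  obtain ⟨F, h₁, h₂, h₃, h₄⟩ := exists_iterate_of_functional (M := M) (S := S)
    (G := fun x y => (G x y ∧ S y) ∧ ∀ z, z < y → ¬ (G x z ∧ S z)) hS inferInstance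
    (fun x y h => h.1.2) (fun x hx => exists_least (P := fun y => G x y ∧ S y) inferInstance (hGS x hx))
    (fun x y z hy hz => by
      rcases lt_trichotomy y z with h | h | h
      · exact (hz.2 y h hy.1).elim
      · exact h
      · exact (hy.2 z h hz.1).elim) hv
  exact ⟨F, h₁, h₂, h₃, fun n x y hx hy => (h₄ n x y hx hy).1.1⟩

/-! ## Truth in a frame -/

theorem IsFrame.mem {W R : M.sets} (h : M.IsFrame W R) {x y : M.Num} (hxy : pairC x y ∈ R) :
    x ∈ W ∧ y ∈ W := by
  obtain ⟨x', y', hx, hy, hz⟩ := h.2 _ hxy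
  obtain ⟨rfl, rfl⟩ := pairC_inj hz
  exact ⟨hx, hy⟩

theorem IsValuation.zero_or_one {W R V : M.sets} (hV : M.IsValuation W R V)
    {w : M.Num} (hw : w ∈ W) (φ : M.Num) :
    Holds V w φ ∨ ¬ Holds V w φ ∧ pairC (pairC w φ) 0 ∈ V := by
  obtain ⟨i, hi⟩ := hV.2.1 w φ hw
  obtain ⟨w', φ', i', -, hi', h⟩ := hV.1 _ hi
  obtain ⟨-, rfl⟩ := pairC_inj h
  rcases hi' with rfl | rfl
  · exact .inr ⟨fun h => zero_ne_one (hV.2.2.1 w φ 0 1 hi h), hi⟩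
  · exact .inl hi

theorem IsValuation.holds_bot {W R V : M.sets} (hV : M.IsValuation W R V)
    {w : M.Num} (hw : w ∈ W) : ¬ Holds V w botC := fun h =>
  zero_ne_one (hV.2.2.1 w botC 0 1 (hV.2.2.2.1 w hw) h)

theorem IsValuation.holds_imp {W R V : M.sets} (hV : M.IsValuation W R V)
    {w φ ψ : M.Num} (hw : w ∈ W) :
    Holds V w (impC φ ψ) ↔ (Holds V w φ → Holds V w ψ) := by
  obtain ⟨k, hk⟩ := hV.2.1 w (impC φ ψ) hw
  have key := hV.2.2.2.2.1 w φ ψ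
  have hk' : k = 1 → Holds V w (impC φ ψ) := fun h => by subst h; exact hk
  rcases hV.zero_or_one hw φ with hφ | ⟨hφ, hφ'⟩
  · rcases hV.zero_or_one hw ψ with hψ | ⟨hψ, hψ'⟩
    · have := key 1 1 k hw hφ hψ hk
      exact iff_of_true (hk' (by rw [mul_one] at this; exact add_right_cancel this)) fun _ => hψ
    · have := key 1 0 k hw hφ hψ' hk
      refine iff_of_false (fun h => ?_) fun h => hψ (h hφ)
      have h1 : k = 1 := hV.2.2.1 w _ k 1 hk h
      rw [h1, mul_zero] at this
      exact one_ne_zero (add_left_cancel this)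
  · obtain ⟨j, hj⟩ := hV.2.1 w ψ hw
    have := key 0 j k hw hφ' hj hk
    exact iff_of_true (hk' (by rwa [zero_mul, add_zero, add_zero] at this)) fun h => (hφ h).elim

theorem IsValuation.holds_neg {W R V : M.sets} (hV : M.IsValuation W R V)
    {w φ : M.Num} (hw : w ∈ W) :
    Holds V w (negC φ) ↔ ¬ Holds V w φ :=
  (hV.holds_imp hw).trans ⟨fun h h' => hV.holds_bot hw (h h'), fun h h' => (h h').elim⟩

theorem IsValuation.holds_dia {W R V : M.sets} (hV : M.IsValuation W R V)
    {w φ : M.Num} (hw : w ∈ W) :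
    Holds V w (diaC φ) ↔ ∃ x, x ∈ W ∧ pairC w x ∈ R ∧ Holds V x φ := by
  refine (hV.holds_neg hw).trans ?_
  rw [hV.holds_box hw]
  push Not
  refine exists_congr fun x => and_congr_right fun hx => and_congr_right fun _ => ?_
  rw [hV.holds_neg hx, not_not]

theorem IsValuation.holds_loeb {W R V : M.sets} (hV : M.IsValuation W R V)
    (ht : M.Transitive R)
    (ha : ¬ ∃ F : M.sets, M.IsAscending W R F) {w φ : M.Num} (hw : w ∈ W)
    (h : Holds V w (boxC (impC (boxC φ) φ))) : Holds V w (boxC φ) := by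
  rw [hV.holds_box hw] at h ⊢
  by_contra hc
  push Not at hc
  obtain ⟨v, hv, hwv, hvφ⟩ := hc
  obtain ⟨F, h₁, h₂, h₃, h₄⟩ := exists_iterate (M := M)
    (S := fun x => x ∈ W ∧ pairC w x ∈ R ∧ ¬ pairC (pairC x φ) 1 ∈ V)
    (G := fun x y => pairC x y ∈ R) inferInstance inferInstance
    (fun x ⟨hx, hwx, hxφ⟩ => by
      have h' := mt ((hV.holds_imp hx).1 (h x hx hwx)) hxφ
      rw [hV.holds_box hx] at h'
      push Not at h'
      obtain ⟨y, hy, hxy, hyφ⟩ := h'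
      exact ⟨y, hxy, hy, ht _ _ _ hwx hxy, hyφ⟩) ⟨hv, hwv, hvφ⟩
  exact ha ⟨F, fun z hz => let ⟨n, x, hx, hz⟩ := h₁ z hz; ⟨n, x, hx.1, hz⟩, h₂, h₃, h₄⟩

theorem IsValuation.holds_isAxm {W R V : M.sets} (hV : M.IsValuation W R V)
    {τ y x w : M.Num} (hy : M.IsAxm y) (hx : M.Subst τ y x)
    (hw : w ∈ W) : Holds V w x := by
  obtain ⟨A, hA⟩ := exists_subst τ (pC : M.Num)
  obtain ⟨B, hB⟩ := exists_subst τ (qC : M.Num)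
  obtain ⟨C, hC⟩ := exists_subst τ (rC : M.Num)
  rcases hy with rfl | rfl | rfl | rfl
  · rw [hx.unique (hA.imp (hB.imp hA)), hV.holds_imp hw, hV.holds_imp hw]
    exact fun h _ => h
  · rw [hx.unique ((hA.imp (hB.imp hC)).imp ((hA.imp hB).imp (hA.imp hC)))]
    simp only [hV.holds_imp hw]
    exact fun h h' h'' => h h'' (h' h'')
  · rw [hx.unique ((hA.neg.imp hB.neg).imp (hB.imp hA))]
    simp only [hV.holds_imp hw, hV.holds_neg hw]
    exact fun h hB => by_contra fun hA => h hA hB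
  · rw [hx.unique ((hA.imp hB).box.imp (hA.box.imp hB.box))]
    simp only [hV.holds_imp hw, hV.holds_box hw]
    exact fun h h' v hv hwv => (hV.holds_imp hv).1 (h v hv hwv) (h' v hv hwv)

theorem IsValuation.holds_isLogic {W R V : M.sets} (hV : M.IsValuation W R V)
    {Sg : M.sets} (hSg : M.IsLogic Sg) (hR : M.IsFrame W R)
    (hA : M.Appropriate Sg W R) {τ y x w : M.Num} (hy : y ∈ Sg) (hx : M.Subst τ y x)
    (hw : w ∈ W) : Holds V w x := by
  obtain ⟨A, hp⟩ := exists_subst τ (pC : M.Num)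
  obtain ⟨hT, hB, h4, h5, hD, h2, hL⟩ := hA
  rcases hSg y hy with rfl | rfl | rfl | rfl | rfl | rfl | rfl
  · rw [hx.unique (hp.box.imp hp), hV.holds_imp hw, hV.holds_box hw]
    exact fun h => h w hw (hT hy w hw)
  · rw [hx.unique (hp.imp hp.dia.box), hV.holds_imp hw, hV.holds_box hw]
    exact fun h v hv hwv => (hV.holds_dia hv).2 ⟨w, hw, hB hy _ _ hwv, h⟩
  · rw [hx.unique (hp.box.imp hp.box.box), hV.holds_imp hw, hV.holds_box hw, hV.holds_box hw]
    exact fun h v hv hwv => (hV.holds_box hv).2 fun u hu hvu => h u hu (h4 hy _ _ _ hwv hvu)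
  · rw [hx.unique (hp.dia.imp hp.dia.box), hV.holds_imp hw, hV.holds_box hw, hV.holds_dia hw]
    exact fun ⟨u, hu, hwu, h⟩ v hv hwv => (hV.holds_dia hv).2 ⟨u, hu, h5 hy _ _ _ hwv hwu, h⟩
  · rw [hx.unique (hp.box.imp hp.dia), hV.holds_imp hw, hV.holds_box hw, hV.holds_dia hw]
    intro h
    obtain ⟨u, hwu⟩ := hD hy w hw
    exact ⟨u, (hR.mem hwu).2, hwu, h u (hR.mem hwu).2 hwu⟩
  · rw [hx.unique (hp.box.dia.imp hp.dia.box), hV.holds_imp hw, hV.holds_box hw, hV.holds_dia hw]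
    rintro ⟨u, hu, hwu, h⟩ v hv hwv
    obtain ⟨s, hus, hvs⟩ := h2 hy _ _ _ hwu hwv
    have hs := (hR.mem hus).2
    exact (hV.holds_dia hv).2 ⟨s, hs, hvs, (hV.holds_box hu).1 h s hs hus⟩
  · rw [hx.unique ((hp.box.imp hp).box.imp hp.box), hV.holds_imp hw]
    exact hV.holds_loeb (hL hy).1 (hL hy).2 hw

/-- Every substitution instance of every entry of a proof is true everywhere. -/
theorem IsValuation.holds_of_prf {W R V : M.sets} (hV : M.IsValuation W R V)
    {Sg : M.sets} (hSg : M.IsLogic Sg) (hR : M.IsFrame W R)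
    (hA : M.Appropriate Sg W R) {p : M.Num} (hp : M.Prf Sg p) {i y τ x w : M.Num}
    (hy : M.Entry p i y) (hx : M.Subst τ y x) (hw : w ∈ W) : Holds V w x := by
  refine p1_strong_induction (M := M) (P := fun i => ∀ y τ x w, M.Entry p i y → M.Subst τ y x →
    w ∈ W → pairC (pairC w x) 1 ∈ V) inferInstance
    (fun k ih y τ x w hy hx hw => ?_) i y τ x w hy hx hw
  rcases hp.2 k y hy with h | h | ⟨i, j, z, z', hi, hj, hz, hz', rfl⟩ | ⟨i, z, hi, hz, rfl⟩ |
    ⟨i, z, σ, hi, hz, -, hσ⟩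
  · exact hV.holds_isLogic hSg hR hA h hx hw
  · exact hV.holds_isAxm h hx hw
  · obtain ⟨v, hv⟩ := exists_subst τ z'
    exact (hV.holds_imp hw).1 (ih i hi _ τ _ w hz (hv.imp hx) hw) (ih j hj z' τ v w hz' hv hw)
  · obtain ⟨v, hv, rfl⟩ := hx.box_inv
    exact (hV.holds_box hw).2 fun u hu _ => ih i hi z τ v u hz hv hu
  · obtain ⟨ρ, hρ⟩ := exists_subst_comp σ τ (z + 1)
    exact ih i hi z ρ x w hz (hρ z (lt_succ_iff.2 le_rfl) y x hσ hx) hw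

end L2Structure
end SOA

/-- Every model of `RCA₀` satisfies the sentence stating the soundness theorem. -/
theorem mainTheorem7 (M : SOA.L2Structure.{u}) (hM : M.IsModelRCA0) :
    M.Models SOA.Fm.soundness := by
  have : Fact M.IsModelRCA0 := ⟨hM⟩
  intro e E
  rw [SOA.sat_soundness]
  rintro Sg hSg φ ⟨p, hp, i, hi⟩ W R hR hA V hV w hw
  obtain ⟨x, hx⟩ := SOA.L2Structure.exists_subst (SOA.pairC (SOA.pairC 0 0) 0) φ
  have := hV.holds_of_prf hSg hR hA hp hi hx hw
  rwa [hx.empty] at this
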